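/- **Signatures.** Fix a countably infinite set $\mathrm{Var}$ of variables. A many-sorted signature $\mathcal L$ consists of countable sets of relation and function symbols with arities $n\ge 0$; a nonempty countable set $\mathrm{Sort}$; pairwise disjoint infinite sets $\mathrm{Var}_i\subseteq\mathrm{Var}$ of variables of sort $i$ ($i\in\mathrm{Sort}$); for each $n$-ary relation symbol $R$ a nonempty set $\mathrm{rank}(R)\subseteq\mathrm{Sort}^n$; and for each $n$-ary function symbol $f$ a nonempty partial function $\mathrm{rank}(f)$ from $\mathrm{Sort}^n$ to $\mathrm{Sort}$. A variable in $\mathrm{Var}_i$ is a well-sorted term of sort $i$; if $t_1,\dots,t_n$ are well-sorted of sorts $i_1,\dots,i_n$ and $\mathrm{rank}(f)(i_1,\dots,i_n)=i$, then $f(t_1,\dots,t_n)$ is well-sorted of sort $i$. The well-sorted formulas ($\mathcal L$-formulas) are built by $\land,\lor,\to$, and $\forall x^i,\exists x^i$ with $x^i\in\mathrm{Var}_i$, from $\bot$, equations $t_1=t_2$ between terms of the same sort, and $R(t_1,\dots,t_n)$ with $(i_1,\dots,i_n)\in\mathrm{rank}(R)$, where $i_k$ is the sort of $t_k$. An $\mathcal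 L$-sentence is an $\mathcal L$-formula without free variables. **Derivability.** $\Pi\vdash_{\mathrm{FOL}}A$ means that $A$ has a derivation from $\Pi$ in classical natural deduction for unsorted first-order logic, where the universal closures of the usual equality axioms (reflexivity, symmetry, transitivity, congruence for every relation and function symbol) may be used. $\Gamma\vdash^{\mathcal L}_{\mathrm{MSL}}\varphi$ means the same with only $\mathcal L$-formulas in the derivation, with a variable of sort $i$ instantiated only by terms of sort $i$, and with the equality axioms restricted to their well-sorted instances in which $x$ and $y$ have the same sort in every equation $x=y$ between variables. **Liberal equality.** $\mathcal L^{\approx}$ is $\mathcal L$ with an additional binary relation symbol $\approx$ of rank $\mathrm{Sort}\times\mathrm{Sort}$. $\mathrm{Eq}^{\approx}_{\mathcal L}$ is the set of universal closures of: $x^i\approx x^i$; $x^i\approx y^j\to y^j\approx x^i$; $x^i\approx y^j\land y^j\approx z^k\to x^i\approx z^k$; $\bigwedge_k x_k^{i_k}\approx y_k^{j_k}\to(R(\vec x)\to R(\vec y))$ whenever both $R$-atoms are well-sorted, for relation symbols $R$ of $\mathcal L$; $\bigwedge_k x_k^{i_k}\approx y_k^{j_k}\to f(\vec x)\approx f(\vec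 y)$ whenever both $f$-terms are well-sorted; $x^i=y^i\to x^i\approx y^i$; $x^i\approx y^i\to x^i=y^i$. Write $\Gamma\vdash^{\mathcal L}_{\mathrm{MSL}^{\approx}}\varphi$ for $\Gamma,\mathrm{Eq}^{\approx}_{\mathcal L}\vdash^{\mathcal L^{\approx}}_{\mathrm{MSL}}\varphi$. **Translation.** The unsorted signature $\mathcal L^*$ has the symbols of $\mathcal L$ and a fresh unary relation symbol $Q_i$ for each sort $i$. For $\mathcal L^{\approx}$-formulas, $\varphi^*$ is defined by $\bot^*=\bot$, $(t_1=t_2)^*=(t_1\approx t_2)^*=(t_1=t_2)$, $R(\vec t)^*=R(\vec t)$ for $R$ in $\mathcal L$, $(\varphi\star\psi)^*=\varphi^*\star\psi^*$ for $\star\in\{\land,\lor,\to\}$, $(\forall x^i\varphi)^*=\forall x(Q_ix\to\varphi^*)$, $(\exists x^i\varphi)^*=\exists x(Q_ix\land\varphi^*)$; and $\Gamma^*=\{\psi^*:\psi\in\Gamma\}$. $J$ is the set of universal closures of $\exists x\,Q_ix$ for each sort $i$, and of $Q_{i_1}x_1\land\dots\land Q_{i_n}x_n\to Q_if(x_1,\dots,x_n)$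 for each function symbol $f$ with $\mathrm{rank}(f)(i_1,\dots,i_n)=i$. **Corollary.** Let $\mathcal L$ be a many-sorted signature and $\Gamma\cup\{\varphi\}$ a set of $\mathcal L^{\approx}$-sentences. Then $$\Gamma\vdash^{\mathcal L}_{\mathrm{MSL}^{\approx}}\varphi\quad\text{if and only if}\quad\Gamma^*,J\vdash_{\mathrm{FOL}}\varphi^*.$$ -/

import Mathlib

universe u v w

/- Unsorted first-order syntax. Signatures are Mathlib's `FirstOrder.Language`s, terms are Mathlib's
`L.Term ℕ` (the set of variables is `ℕ`). Formulas have named variables and all of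
`⊥, =, ∧, ∨, →, ∀, ∃` as primitives. -/

/-- First-order formulas over the signature `L`, with variables in `ℕ`. -/
inductive Fml (L : FirstOrder.Language.{u, v}) : Type (max u v)
  | bot : Fml L
  | eq (s t : L.Term ℕ) : Fml L
  | rel {n : ℕ} (R : L.Relations n) (ts : Fin n → L.Term ℕ) : Fml L
  | con (A B : Fml L) : Fml L
  | dis (A B : Fml L) : Fml L
  | imp (A B : Fml L) : Fml L
  | all (x : ℕ) (A : Fml L) : Fml L
  | ex (x : ℕ) (A : Fml L) : Fml L

namespace Fml

variable {L : FirstOrder.Language.{u, v}}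

/-- Negation `¬ A`, i.e. `A → ⊥`. -/
def neg (A : Fml L) : Fml L := imp A bot

/-- The set of free variables. -/
def fv : Fml L → Finset ℕ
  | bot => ∅
  | eq s t => s.varFinset ∪ t.varFinset
  | rel _ ts => Finset.univ.biUnion fun k => (ts k).varFinset
  | con A B => A.fv ∪ B.fv
  | dis A B => A.fv ∪ B.fv
  | imp A B => A.fv ∪ B.fv
  | all x A => A.fv.erase x
  | ex x A => A.fv.erase x

/-- The term `s[t/x]`. -/
def substTerm (x : ℕ) (t s : L.Term ℕ) : L.Term ℕ :=
  s.subst (Function.update FirstOrder.Language.Term.var x t)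

/-- `A.subst x t` is `A[t/x]`: every free occurrence of `x` in `A` is replaced by `t`. No bound
variable is renamed; see `FreeFor`. -/
def subst (x : ℕ) (t : L.Term ℕ) : Fml L → Fml L
  | bot => bot
  | eq s r => eq (substTerm x t s) (substTerm x t r)
  | rel R ts => rel R fun k => substTerm x t (ts k)
  | con A B => con (subst x t A) (subst x t B)
  | dis A B => dis (subst x t A) (subst x t B)
  | imp A B => imp (subst x t A) (subst x t B)
  | all y A => if y = x then all y A else all y (subst x t A)
  | ex y A => if y = x then ex y A else ex y (subst x t A)

/-- The term `t` is free for `x` in the formula: no free occurrence of `x` lies in the scope of a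
quantifier binding a variable of `t`. -/
def FreeFor (x : ℕ) (t : L.Term ℕ) : Fml L → Prop
  | bot => True
  | eq _ _ => True
  | rel _ _ => True
  | con A B => FreeFor x t A ∧ FreeFor x t B
  | dis A B => FreeFor x t A ∧ FreeFor x t B
  | imp A B => FreeFor x t A ∧ FreeFor x t B
  | all y A => x ∉ (all y A).fv ∨ (y ∉ t.varFinset ∧ FreeFor x t A)
  | ex y A => x ∉ (ex y A).fv ∨ (y ∉ t.varFinset ∧ FreeFor x t A)

/-- The universal closure: all free variables are universally quantified (in increasing order). -/
def close (A : Fml L) : Fml L := (A.fv.sort (· ≤ ·)).foldr all A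

/-- The conjunction `A ∧ (A₁ ∧ (⋯ ∧ Aₙ))` of the nonempty list `A, A₁, …, Aₙ`. -/
def conjList : Fml L → List (Fml L) → Fml L
  | A, [] => A
  | A, B :: l => con A (conjList B l)

/-- `A₁ ∧ ⋯ ∧ Aₙ → B`; this is just `B` if `n = 0`. -/
def impList : List (Fml L) → Fml L → Fml L
  | [], B => B
  | A :: l, B => imp (conjList A l) B

/-- The variable `x` as a term. -/
abbrev vt (x : ℕ) : L.Term ℕ := FirstOrder.Language.Term.var x

end Fml

open Fml in
/-- Natural deduction. `Deriv W Inst Ax Γ A` says that there is a natural deduction derivation of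
`A` in which all formulas satisfy `W`, all of whose undischarged assumptions lie in `Γ`, which may
use the elements of `Ax` as axioms, and in which `∀E` and `∃I` instantiate a variable `x` by a term
`t` only if `Inst x t` holds.
The conditions `W _` are imposed where the premises of a rule do not guarantee them. -/
inductive Deriv {L : FirstOrder.Language.{u, v}} (W : Fml L → Prop) (Inst : ℕ → L.Term ℕ → Prop)
    (Ax : Set (Fml L)) : Set (Fml L) → Fml L → Prop
  | assumption {Γ : Set (Fml L)} {A : Fml L} : A ∈ Γ → W A → Deriv W Inst Ax Γ A
  | ax {Γ : Set (Fml L)} {A : Fml L} : A ∈ Ax → W A → Deriv W Inst Ax Γ A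
  | weaken {Γ Δ : Set (Fml L)} {A : Fml L} : Γ ⊆ Δ → Deriv W Inst Ax Γ A → Deriv W Inst Ax Δ A
  | conI {Γ : Set (Fml L)} {A B : Fml L} :
      Deriv W Inst Ax Γ A → Deriv W Inst Ax Γ B → Deriv W Inst Ax Γ (con A B)
  | conE₁ {Γ : Set (Fml L)} {A B : Fml L} : Deriv W Inst Ax Γ (con A B) → Deriv W Inst Ax Γ A
  | conE₂ {Γ : Set (Fml L)} {A B : Fml L} : Deriv W Inst Ax Γ (con A B) → Deriv W Inst Ax Γ B
  | disI₁ {Γ : Set (Fml L)} {A B : Fml L} :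
      W B → Deriv W Inst Ax Γ A → Deriv W Inst Ax Γ (dis A B)
  | disI₂ {Γ : Set (Fml L)} {A B : Fml L} :
      W A → Deriv W Inst Ax Γ B → Deriv W Inst Ax Γ (dis A B)
  | disE {Γ : Set (Fml L)} {A B C : Fml L} : Deriv W Inst Ax Γ (dis A B) →
      Deriv W Inst Ax (insert A Γ) C → Deriv W Inst Ax (insert B Γ) C → Deriv W Inst Ax Γ C
  | impI {Γ : Set (Fml L)} {A B : Fml L} :
      W A → Deriv W Inst Ax (insert A Γ) B → Deriv W Inst Ax Γ (imp A B)
  | impE {Γ : Set (Fml L)} {A B : Fml L} :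
      Deriv W Inst Ax Γ (imp A B) → Deriv W Inst Ax Γ A → Deriv W Inst Ax Γ B
  | botE {Γ : Set (Fml L)} {A : Fml L} : W A → Deriv W Inst Ax Γ bot → Deriv W Inst Ax Γ A
  | raa {Γ : Set (Fml L)} {A : Fml L} :
      W A → Deriv W Inst Ax (insert (neg A) Γ) bot → Deriv W Inst Ax Γ A
  | allI {Γ : Set (Fml L)} {x : ℕ} {A : Fml L} : (∀ B ∈ Γ, x ∉ B.fv) → W (all x A) →
      Deriv W Inst Ax Γ A → Deriv W Inst Ax Γ (all x A)
  | allE {Γ : Set (Fml L)} {x : ℕ} {A : Fml L} {t : L.Term ℕ} : FreeFor x t A → Inst x t →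
      Deriv W Inst Ax Γ (all x A) → Deriv W Inst Ax Γ (subst x t A)
  | exI {Γ : Set (Fml L)} {x : ℕ} {A : Fml L} {t : L.Term ℕ} : FreeFor x t A → Inst x t →
      W (ex x A) → Deriv W Inst Ax Γ (subst x t A) → Deriv W Inst Ax Γ (ex x A)
  | exE {Γ Δ : Set (Fml L)} {x : ℕ} {A C : Fml L} : (∀ B ∈ Δ, x ∉ B.fv) → x ∉ C.fv →
      Deriv W Inst Ax Γ (ex x A) → Deriv W Inst Ax (insert A Δ) C → Deriv W Inst Ax (Γ ∪ Δ) C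

namespace FOL

open Fml

/-- The equality axioms of unsorted first-order logic over `L` (universal closures). -/
inductive EqAx (L : FirstOrder.Language.{u, v}) : Set (Fml L)
  | refl (x : ℕ) : EqAx L (close (eq (vt x) (vt x)))
  | symm (x y : ℕ) : EqAx L (close (imp (eq (vt x) (vt y)) (eq (vt y) (vt x))))
  | trans (x y z : ℕ) :
      EqAx L (close (imp (con (eq (vt x) (vt y)) (eq (vt y) (vt z))) (eq (vt x) (vt z))))
  | rel {n : ℕ} (R : L.Relations n) (x y : Fin n → ℕ) :
      EqAx L (close (impList (List.ofFn fun k => eq (vt (x k)) (vt (y k)))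
        (imp (rel R fun k => vt (x k)) (rel R fun k => vt (y k)))))
  | func {n : ℕ} (f : L.Functions n) (x y : Fin n → ℕ) :
      EqAx L (close (impList (List.ofFn fun k => eq (vt (x k)) (vt (y k)))
        (eq (.func f fun k => vt (x k)) (.func f fun k => vt (y k)))))

/-- `P ⊢_FOL A`: `A` is derivable from `P` in classical first-order logic with equality. -/
def Derives {L : FirstOrder.Language.{u, v}} (P : Set (Fml L)) (A : Fml L) : Prop :=
  Deriv (fun _ => True) (fun _ _ => True) (EqAx L) P A

end FOL

/-- A many-sorted signature with underlying unsorted signature `L` and set of sorts `ι`.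
`Var_i` is the set of `x` with `varSort x = some i`; a variable may have no sort.
`funRank f i` is the value of the partial function `rank(f)` at `i`, if defined. -/
structure ManySortedSignature (L : FirstOrder.Language.{u, v}) (ι : Type w) where
  symbols_countable : Countable L.Symbols
  sort_countable : Countable ι
  sort_nonempty : Nonempty ι
  varSort : ℕ → Option ι
  varSort_infinite : ∀ i : ι, {x : ℕ | varSort x = some i}.Infinite
  relRank : ∀ {n : ℕ}, L.Relations n → Set (Fin n → ι)
  relRank_nonempty : ∀ {n : ℕ} (R : L.Relations n), (relRank R).Nonempty
  funRank : ∀ {n : ℕ}, L.Functions n → (Fin n → ι) → Option ι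
  funRank_nonempty : ∀ {n : ℕ} (f : L.Functions n), ∃ i j, funRank f i = some j

namespace ManySortedSignature

open Fml

variable {L : FirstOrder.Language.{u, v}} {ι : Type w}

/-- `S.HasSort t i`: the term `t` is well sorted, of sort `i`. -/
inductive HasSort (S : ManySortedSignature L ι) : L.Term ℕ → ι → Prop
  | var {x : ℕ} {i : ι} : S.varSort x = some i → HasSort S (.var x) i
  | func {n : ℕ} {f : L.Functions n} {ts : Fin n → L.Term ℕ} {i : Fin n → ι} {j : ι} :
      (∀ k, HasSort S (ts k) (i k)) → S.funRank f i = some j → HasSort S (.func f ts) j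

/-- The well-sorted formulas. -/
def WellSorted (S : ManySortedSignature L ι) : Fml L → Prop
  | bot => True
  | eq s t => ∃ i, S.HasSort s i ∧ S.HasSort t i
  | rel R ts => ∃ i ∈ S.relRank R, ∀ k, S.HasSort (ts k) (i k)
  | con A B => WellSorted S A ∧ WellSorted S B
  | dis A B => WellSorted S A ∧ WellSorted S B
  | imp A B => WellSorted S A ∧ WellSorted S B
  | all x A => (∃ i, S.varSort x = some i) ∧ WellSorted S A
  | ex x A => (∃ i, S.varSort x = some i) ∧ WellSorted S A

/-- The well-sorted sentences. -/
def IsSentence (S : ManySortedSignature L ι) (A : Fml L) : Prop :=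
  S.WellSorted A ∧ A.fv = ∅

/-- The axioms (universal closures) for strict equality in many-sorted logic. -/
inductive EqAx (S : ManySortedSignature L ι) : Set (Fml L)
  | refl {x : ℕ} {i : ι} : S.varSort x = some i → EqAx S (close (eq (vt x) (vt x)))
  | symm {x y : ℕ} {i : ι} : S.varSort x = some i → S.varSort y = some i →
      EqAx S (close (imp (eq (vt x) (vt y)) (eq (vt y) (vt x))))
  | trans {x y z : ℕ} {i : ι} :
      S.varSort x = some i → S.varSort y = some i → S.varSort z = some i →
      EqAx S (close (imp (con (eq (vt x) (vt y)) (eq (vt y) (vt z))) (eq (vt x) (vt z))))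
  | rel {n : ℕ} {R : L.Relations n} {i : Fin n → ι} {x y : Fin n → ℕ} : i ∈ S.relRank R →
      (∀ k, S.varSort (x k) = some (i k)) → (∀ k, S.varSort (y k) = some (i k)) →
      EqAx S (close (impList (List.ofFn fun k => eq (vt (x k)) (vt (y k)))
        (imp (rel R fun k => vt (x k)) (rel R fun k => vt (y k)))))
  | func {n : ℕ} {f : L.Functions n} {i : Fin n → ι} {j : ι} {x y : Fin n → ℕ} :
      S.funRank f i = some j →
      (∀ k, S.varSort (x k) = some (i k)) → (∀ k, S.varSort (y k) = some (i k)) →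
      EqAx S (close (impList (List.ofFn fun k => eq (vt (x k)) (vt (y k)))
        (eq (.func f fun k => vt (x k)) (.func f fun k => vt (y k)))))

/-- `Γ ⊢_MSL A` over the many-sorted signature `S`: only well-sorted formulas are used, and a
variable is only instantiated by terms of the same sort. -/
def Derives (S : ManySortedSignature L ι) (Γ : Set (Fml L)) (A : Fml L) : Prop :=
  Deriv S.WellSorted (fun x t => ∃ i, S.varSort x = some i ∧ S.HasSort t i) S.EqAx Γ A

end ManySortedSignature

/-- The relation symbols of `L`, and the new binary relation symbol `≈`. -/
inductive ApproxRel (L : FirstOrder.Language.{u, v}) : ℕ → Type v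
  | base {n : ℕ} (R : L.Relations n) : ApproxRel L n
  | approx : ApproxRel L 2

/-- The unsorted signature underlying `𝓛^≈`. -/
def FirstOrder.Language.withApprox (L : FirstOrder.Language.{u, v}) :
    FirstOrder.Language.{u, v} where
  Functions := L.Functions
  Relations := ApproxRel L

theorem FirstOrder.Language.countable_withApprox (L : FirstOrder.Language.{u, v})
    (h : Countable L.Symbols) : Countable L.withApprox.Symbols := by
  let g : Option L.Symbols → L.withApprox.Symbols := fun s =>
    match s with
    | none => .inr ⟨2, (ApproxRel.approx : ApproxRel L 2)⟩
    | some (.inl f) => .inl f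
    | some (.inr R) => .inr ⟨R.1, (ApproxRel.base R.2 : ApproxRel L R.1)⟩
  refine Function.Surjective.countable (f := g) ?_
  rintro (a | ⟨n, R | _⟩)
  · exact ⟨some (.inl a), rfl⟩
  · exact ⟨some (.inr ⟨n, R⟩), rfl⟩
  · exact ⟨none, rfl⟩

/-- The relation symbols of `L`, and a new unary relation symbol `Q_i` for every sort `i`. -/
inductive StarRel (L : FirstOrder.Language.{u, v}) (ι : Type w) : ℕ → Type (max v w)
  | base {n : ℕ} (R : L.Relations n) : StarRel L ι n
  | sortPred (i : ι) : StarRel L ι 1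

/-- The unsorted signature `𝓛^*`. -/
def FirstOrder.Language.withSorts (L : FirstOrder.Language.{u, v}) (ι : Type w) :
    FirstOrder.Language.{u, max v w} where
  Functions := L.Functions
  Relations := StarRel L ι

namespace ManySortedSignature

open Fml

variable {L : FirstOrder.Language.{u, v}} {ι : Type w}

/-- The many-sorted signature `𝓛^≈`: `≈` may be applied to terms of arbitrary sorts. -/
def withApprox (S : ManySortedSignature L ι) : ManySortedSignature L.withApprox ι where
  varSort := S.varSort
  varSort_infinite := S.varSort_infinite
  relRank {n} (R : ApproxRel L n) :=
    match n, R with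
    | _, .base R => S.relRank R
    | _, .approx => Set.univ
  relRank_nonempty {n} (R : ApproxRel L n) :=
    match n, R with
    | _, .base R => S.relRank_nonempty R
    | _, .approx => S.sort_nonempty.elim fun i => ⟨fun _ => i, trivial⟩
  funRank {n} (f : L.Functions n) := S.funRank f
  funRank_nonempty {n} (f : L.Functions n) := S.funRank_nonempty f
  symbols_countable := L.countable_withApprox S.symbols_countable
  sort_countable := S.sort_countable
  sort_nonempty := S.sort_nonempty

/-- The formula `s ≈ t`. -/
def approx (s t : L.withApprox.Term ℕ) : Fml L.withApprox :=
  rel (n := 2) (ApproxRel.approx : ApproxRel L 2) ![s, t]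

/-- The set `Eq^≈` of axioms (universal closures) for liberal equality. -/
inductive ApproxAx (S : ManySortedSignature L ι) : Set (Fml L.withApprox)
  | refl {x : ℕ} {i : ι} : S.varSort x = some i → ApproxAx S (close (approx (vt x) (vt x)))
  | symm {x y : ℕ} {i j : ι} : S.varSort x = some i → S.varSort y = some j →
      ApproxAx S (close (imp (approx (vt x) (vt y)) (approx (vt y) (vt x))))
  | trans {x y z : ℕ} {i j k : ι} :
      S.varSort x = some i → S.varSort y = some j → S.varSort z = some k →
      ApproxAx S (close (imp (con (approx (vt x) (vt y)) (approx (vt y) (vt z)))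
        (approx (vt x) (vt z))))
  | rel {n : ℕ} {R : L.Relations n} {i j : Fin n → ι} {x y : Fin n → ℕ} :
      i ∈ S.relRank R → j ∈ S.relRank R →
      (∀ k, S.varSort (x k) = some (i k)) → (∀ k, S.varSort (y k) = some (j k)) →
      ApproxAx S (close (impList (List.ofFn fun k => approx (vt (x k)) (vt (y k)))
        (imp (rel (ApproxRel.base R : ApproxRel L n) fun k => vt (x k))
          (rel (ApproxRel.base R : ApproxRel L n) fun k => vt (y k)))))
  | func {n : ℕ} {f : L.Functions n} {i j : Fin n → ι} {i' j' : ι} {x y : Fin n → ℕ} :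
      S.funRank f i = some i' → S.funRank f j = some j' →
      (∀ k, S.varSort (x k) = some (i k)) → (∀ k, S.varSort (y k) = some (j k)) →
      ApproxAx S (close (impList (List.ofFn fun k => approx (vt (x k)) (vt (y k)))
        (approx (.func (f : L.Functions n) fun k => vt (x k))
          (.func (f : L.Functions n) fun k => vt (y k)))))
  | of_eq {x y : ℕ} {i : ι} : S.varSort x = some i → S.varSort y = some i →
      ApproxAx S (close (imp (eq (vt x) (vt y)) (approx (vt x) (vt y))))
  | to_eq {x y : ℕ} {i : ι} : S.varSort x = some i → S.varSort y = some i →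
      ApproxAx S (close (imp (approx (vt x) (vt y)) (eq (vt x) (vt y))))

/-- `Γ ⊢_{MSL^≈} A` over the many-sorted signature `S`, for `Γ` and `A` over `𝓛^≈`. -/
def DerivesApprox (S : ManySortedSignature L ι) (Γ : Set (Fml L.withApprox))
    (A : Fml L.withApprox) : Prop :=
  S.withApprox.Derives (Γ ∪ S.ApproxAx) A

/-- A term over `𝓛^≈`, read as a term over `𝓛^*`; both have the function symbols of `L`. -/
def starTerm (ι : Type w) : L.withApprox.Term ℕ → (L.withSorts ι).Term ℕ
  | .var x => .var x
  | .func (f : L.Functions _) ts => .func (f : L.Functions _) fun k => starTerm ι (ts k)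

/-- The formula `Q_i t`. -/
def sortPred (i : ι) (t : (L.withSorts ι).Term ℕ) : Fml (L.withSorts ι) :=
  rel (n := 1) (StarRel.sortPred i : StarRel L ι 1) ![t]

/-- The translation of an atomic formula with a relation symbol of `𝓛^≈`. -/
def starRel : {n : ℕ} → ApproxRel L n → (Fin n → (L.withSorts ι).Term ℕ) → Fml (L.withSorts ι)
  | _, .base R, ts => rel (StarRel.base R : StarRel L ι _) ts
  | _, .approx, ts => eq (ts 0) (ts 1)

/-- The translation `A ↦ A^*` of formulas over `𝓛^≈`. (Quantifiers over variables without a sort do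
not occur in well-sorted formulas; they are left alone.) -/
def star (S : ManySortedSignature L ι) : Fml L.withApprox → Fml (L.withSorts ι)
  | bot => bot
  | eq s t => eq (starTerm ι s) (starTerm ι t)
  | rel (R : ApproxRel L _) ts => starRel R fun k => starTerm ι (ts k)
  | con A B => con (star S A) (star S B)
  | dis A B => dis (star S A) (star S B)
  | imp A B => imp (star S A) (star S B)
  | all x A =>
    match S.varSort x with
    | some i => all x (imp (sortPred i (vt x)) (star S A))
    | none => all x (star S A)
  | ex x A =>
    match S.varSort x with
    | some i => ex x (con (sortPred i (vt x)) (star S A))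
    | none => ex x (star S A)

/-- The set `J` of sort axioms (universal closures). -/
inductive SortAx (S : ManySortedSignature L ι) : Set (Fml (L.withSorts ι))
  | nonempty (x : ℕ) (i : ι) : SortAx S (ex x (sortPred i (vt x)))
  | func {n : ℕ} {f : L.Functions n} {i : Fin n → ι} {j : ι} (x : Fin n → ℕ) :
      S.funRank f i = some j →
      SortAx S (close (impList (List.ofFn fun k => sortPred (i k) (vt (x k)))
        (sortPred j (.func (f : L.Functions n) fun k => vt (x k)))))

end ManySortedSignature

/-! ### Substitution in terms -/

namespace FirstOrder.Language.Term

variable {L : FirstOrder.Language.{u, v}}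

/-! From MSL^≈ to FOL, the derivation itself is translated. The translation of a formula with free
variables behaves correctly only if these lie in their sorts, so the induction (`derives_star`) runs
under the assumptions `sortHyps`: Q_i x for every variable x of sort i. Rules that bind x discharge
Q_i x; instantiation by a term t of sort i needs Q_i t, which J provides (`derives_sortPred`). Both
equalities become =, so the translated equality axioms are provable. Finally a derivation uses only
finitely many of the assumptions Q_i x, and these are eliminated one by one with ∃x Q_i x from J
(`derives_of_sortHyps`).

The converse is semantic. If φ is not derivable, then Γ, Eq^≈ and ¬φ are consistent in MSL and
extend to a Henkin set U (`exists_isHenkin`) whose witnesses are ordinary variables, so the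
signature stays unchanged. Terms modulo provable ≈ form an unsorted structure in which Q_i consists
of the classes containing a term of sort i. A class may contain terms of several sorts; this is why
liberal equality is needed: its congruence axioms relate different ranks of the same symbol and make
functions and relations well defined on classes. The structure satisfies J, and under the assignment
of each variable to its class, A^* holds exactly if U derives A (`TermModel.sat_star_iff`).
Soundness of FOL (`FOL.Derives.sat`) then makes φ^* true, against ¬φ in U.

The axioms speak only of variables. Their instances for terms come, in both directions, from
generalizing over fresh variables that do not occur in the terms (`exists_generic`). -/

theorem subst_congr {s : L.Term ℕ} {σ τ : ℕ → L.Term ℕ} (h : ∀ x ∈ s.varFinset, σ x = τ x) :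
    s.subst σ = s.subst τ := by
  induction s with
  | var x => exact h x (by simp [varFinset])
  | func f ts ih =>
    simp only [subst]
    congr 1
    funext k
    exact ih k fun x hx => h x (by simp only [varFinset, Finset.mem_biUnion]; exact ⟨k, by simp, hx⟩)

theorem subst_var_eq (s : L.Term ℕ) : s.subst var = s := by
  induction s with
  | var x => rfl
  | func f ts ih => simp only [subst, ih]

theorem subst_eq_self {s : L.Term ℕ} {σ : ℕ → L.Term ℕ} (h : ∀ x ∈ s.varFinset, σ x = var x) :
    s.subst σ = s :=
  (subst_congr h).trans s.subst_var_eq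

theorem subst_subst (s : L.Term ℕ) (σ τ : ℕ → L.Term ℕ) :
    (s.subst σ).subst τ = s.subst fun x => (σ x).subst τ := by
  induction s with
  | var x => rfl
  | func f ts ih => simp only [subst, ih]

theorem mem_varFinset_subst {s : L.Term ℕ} {σ : ℕ → L.Term ℕ} {y : ℕ} :
    y ∈ (s.subst σ).varFinset ↔ ∃ x ∈ s.varFinset, y ∈ (σ x).varFinset := by
  induction s with
  | var x => simp [subst, varFinset]
  | func f ts ih =>
    simp only [subst, varFinset, Finset.mem_biUnion, Finset.mem_univ, true_and, ih]
    grind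

theorem realize_congr {M : Type*} [L.Structure M] {s : L.Term ℕ} {v v' : ℕ → M}
    (h : ∀ x ∈ s.varFinset, v x = v' x) : s.realize v = s.realize v' := by
  induction s with
  | var x => exact h x (by simp [varFinset])
  | func f ts ih =>
    simp only [realize_func]
    congr 1
    funext k
    exact ih k fun x hx => h x (by simp only [varFinset, Finset.mem_biUnion]; exact ⟨k, by simp, hx⟩)

end FirstOrder.Language.Term

/-! ### Substitution, renaming and free variables in formulas -/

namespace Fml

open FirstOrder.Language

variable {L : FirstOrder.Language.{u, v}}

/-- All variables of a formula, free or bound. -/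
def vars : Fml L → Finset ℕ
  | bot => ∅
  | eq s t => s.varFinset ∪ t.varFinset
  | rel _ ts => Finset.univ.biUnion fun k => (ts k).varFinset
  | con A B => A.vars ∪ B.vars
  | dis A B => A.vars ∪ B.vars
  | imp A B => A.vars ∪ B.vars
  | all x A => insert x A.vars
  | ex x A => insert x A.vars

/-- The number of logical symbols of a formula. -/
def size : Fml L → ℕ
  | bot => 0
  | eq _ _ => 0
  | rel _ _ => 0
  | con A B => A.size + B.size + 1
  | dis A B => A.size + B.size + 1
  | imp A B => A.size + B.size + 1
  | all _ A => A.size + 1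
  | ex _ A => A.size + 1

theorem fv_subset_vars (A : Fml L) : A.fv ⊆ A.vars := by
  induction A with
  | bot | eq | rel => simp [fv, vars]
  | con A B hA hB | dis A B hA hB | imp A B hA hB => exact Finset.union_subset_union hA hB
  | all x A h | ex x A h =>
    exact (Finset.erase_subset _ _).trans (h.trans (Finset.subset_insert _ _))

theorem size_subst (x : ℕ) (t : L.Term ℕ) (A : Fml L) : (subst x t A).size = A.size := by
  induction A with
  | bot | eq | rel => rfl
  | con A B hA hB | dis A B hA hB | imp A B hA hB => simp [subst, size, hA, hB]
  | all y A h | ex y A h => by_cases hy : y = x <;> simp [subst, size, hy, h]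

theorem substTerm_eq_self {x : ℕ} {t s : L.Term ℕ} (h : x ∉ s.varFinset) :
    substTerm x t s = s :=
  Term.subst_eq_self fun y hy => Function.update_of_ne (fun e : y = x => h (e ▸ hy)) _ _

theorem substTerm_vt_self (x : ℕ) (s : L.Term ℕ) : substTerm x (vt x) s = s :=
  Term.subst_eq_self fun y _ => by
    by_cases h : y = x
    · subst h; simp
    · simp [h]

theorem substTerm_substTerm_vt {x y : ℕ} {s : L.Term ℕ} (h : y ∉ s.varFinset) :
    substTerm y (vt x) (substTerm x (vt y) s) = s := by
  rw [substTerm, substTerm, Term.subst_subst]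
  refine Term.subst_eq_self fun z hz => ?_
  by_cases hx : z = x
  · subst hx; simp [Term.subst]
  · have : z ≠ y := fun e => h (e ▸ hz)
    simp [hx, this, Term.subst]

theorem subst_vt_self (x : ℕ) (A : Fml L) : subst x (vt x) A = A := by
  induction A with
  | bot => rfl
  | eq | rel => simp [subst, substTerm_vt_self]
  | con A B hA hB | dis A B hA hB | imp A B hA hB => simp [subst, hA, hB]
  | all y A h | ex y A h => simp [subst, h]

theorem freeFor_vt_self (x : ℕ) (A : Fml L) : FreeFor x (vt x) A := by
  induction A with
  | bot | eq | rel => trivial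
  | con A B hA hB | dis A B hA hB | imp A B hA hB => exact ⟨hA, hB⟩
  | all y A h | ex y A h =>
    by_cases e : y = x
    · subst e; exact Or.inl (by simp [fv])
    · exact Or.inr ⟨by simpa [Term.varFinset] using e, h⟩

theorem freeFor_vt_of_notMem_vars {x y : ℕ} {A : Fml L} (hy : y ∉ A.vars) :
    FreeFor x (vt y) A := by
  induction A with
  | bot | eq | rel => trivial
  | con A B hA hB | dis A B hA hB | imp A B hA hB =>
    simp only [vars, Finset.mem_union, not_or] at hy
    exact ⟨hA hy.1, hB hy.2⟩
  | all z A h | ex z A h =>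
    simp only [vars, Finset.mem_insert, not_or] at hy
    exact Or.inr ⟨by simpa [Term.varFinset] using Ne.symm hy.1, h hy.2⟩

theorem subst_eq_self {x : ℕ} {t : L.Term ℕ} {A : Fml L} (hx : x ∉ A.fv) : subst x t A = A := by
  induction A with
  | bot => rfl
  | eq s t =>
    simp only [fv, Finset.mem_union, not_or] at hx
    simp [subst, substTerm_eq_self hx.1, substTerm_eq_self hx.2]
  | rel R ts =>
    simp only [fv, Finset.mem_biUnion, Finset.mem_univ, true_and, not_exists] at hx
    simp [subst, fun k => substTerm_eq_self (t := t) (hx k)]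
  | con A B h1 h2 | dis A B h1 h2 | imp A B h1 h2 =>
    simp only [fv, Finset.mem_union, not_or] at hx
    simp [subst, h1 hx.1, h2 hx.2]
  | all z A h | ex z A h =>
    by_cases e : z = x
    · simp [subst, e]
    · have : x ∉ A.fv := fun h => hx (by simp [fv, h, Ne.symm e])
      simp [subst, e, h this]

/-- As y occurs nowhere in A, the free y's after the first substitution are exactly the former free
x's. Together with `freeFor_subst_vt` this permits renaming the bound variable of ∃x A. -/
theorem subst_subst_vt {x y : ℕ} {A : Fml L} (hy : y ∉ A.vars) :
    subst y (vt x) (subst x (vt y) A) = A := by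
  induction A with
  | bot => rfl
  | eq s t =>
    simp only [vars, Finset.mem_union, not_or] at hy
    simp [subst, substTerm_substTerm_vt hy.1, substTerm_substTerm_vt hy.2]
  | rel R ts =>
    simp only [vars, Finset.mem_biUnion, Finset.mem_univ, true_and, not_exists] at hy
    simp [subst, fun k => substTerm_substTerm_vt (x := x) (hy k)]
  | con A B hA hB | dis A B hA hB | imp A B hA hB =>
    simp only [vars, Finset.mem_union, not_or] at hy
    simp [subst, hA hy.1, hB hy.2]
  | all z A h | ex z A h =>
    simp only [vars, Finset.mem_insert, not_or] at hy
    have hzy : z ≠ y := Ne.symm hy.1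
    have key : subst y (vt x) A = A := subst_eq_self fun h => hy.2 (fv_subset_vars A h)
    by_cases e : z = x
    · subst e
      simp [subst, hzy, key]
    · simp [subst, hzy, e, h hy.2]

theorem freeFor_subst_vt {x y : ℕ} {A : Fml L} (hy : y ∉ A.vars) :
    FreeFor y (vt x) (subst x (vt y) A) := by
  induction A with
  | bot | eq | rel => trivial
  | con A B hA hB | dis A B hA hB | imp A B hA hB =>
    simp only [vars, Finset.mem_union, not_or] at hy
    exact ⟨hA hy.1, hB hy.2⟩
  | all z A h | ex z A h =>
    simp only [vars, Finset.mem_insert, not_or] at hy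
    by_cases e : z = x
    · simp only [subst, e, if_true]
      refine Or.inl fun hm => hy.2 (fv_subset_vars A ?_)
      simp only [fv, Finset.mem_erase] at hm
      exact hm.2
    · simp only [subst, e, if_false]
      exact Or.inr ⟨by simpa [Term.varFinset] using e, h hy.2⟩

theorem notMem_fv_subst {x : ℕ} {t : L.Term ℕ} (ht : x ∉ t.varFinset) (A : Fml L) :
    x ∉ (subst x t A).fv := by
  have hs : ∀ s : L.Term ℕ, x ∉ (substTerm x t s).varFinset := by
    intro s hs
    obtain ⟨y, -, hy⟩ := Term.mem_varFinset_subst.1 hs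
    by_cases e : y = x
    · subst e; simp only [Function.update_self] at hy; exact ht hy
    · rw [Function.update_of_ne e] at hy
      simp [Term.varFinset] at hy
      exact e hy.symm
  induction A with
  | bot => simp [subst, fv]
  | eq | rel => simp [subst, fv, hs]
  | con A B hA hB | dis A B hA hB | imp A B hA hB => simp [subst, fv, hA, hB]
  | all z A h | ex z A h =>
    by_cases e : z = x
    · simp [subst, fv, e]
    · simp [subst, fv, e, h]

/-! ### Quantifier-free formulas, closures and countability -/

/-- Quantifier-free formulas. -/
def QF : Fml L → Prop
  | bot => True
  | eq _ _ => True
  | rel _ _ => True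
  | con A B => QF A ∧ QF B
  | dis A B => QF A ∧ QF B
  | imp A B => QF A ∧ QF B
  | all _ _ => False
  | ex _ _ => False

/-- Simultaneous substitution in a quantifier-free formula (formulas that start with a quantifier
are left alone). -/
def substAll (σ : ℕ → L.Term ℕ) : Fml L → Fml L
  | bot => bot
  | eq s t => eq (s.subst σ) (t.subst σ)
  | rel R ts => rel R fun k => (ts k).subst σ
  | con A B => con (substAll σ A) (substAll σ B)
  | dis A B => dis (substAll σ A) (substAll σ B)
  | imp A B => imp (substAll σ A) (substAll σ B)
  | all x A => all x A
  | ex x A => ex x A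

theorem QF.subst_eq {A : Fml L} (h : A.QF) (x : ℕ) (t : L.Term ℕ) :
    subst x t A = substAll (Function.update Term.var x t) A := by
  induction A with
  | bot | eq | rel => rfl
  | con A B hA hB | dis A B hA hB | imp A B hA hB => simp [subst, substAll, hA h.1, hB h.2]
  | all | ex => exact h.elim

theorem QF.freeFor {A : Fml L} (h : A.QF) (x : ℕ) (t : L.Term ℕ) : FreeFor x t A := by
  induction A with
  | bot | eq | rel => trivial
  | con A B hA hB | dis A B hA hB | imp A B hA hB => exact ⟨hA h.1, hB h.2⟩
  | all | ex => exact h.elim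

theorem QF.substAll {A : Fml L} (h : A.QF) (σ : ℕ → L.Term ℕ) : (A.substAll σ).QF := by
  induction A with
  | bot | eq | rel => trivial
  | con A B hA hB | dis A B hA hB | imp A B hA hB => exact ⟨hA h.1, hB h.2⟩
  | all | ex => exact h.elim

theorem substAll_substAll (A : Fml L) (σ τ : ℕ → L.Term ℕ) :
    (A.substAll σ).substAll τ = A.substAll fun x => (σ x).subst τ := by
  induction A with
  | bot | all | ex => rfl
  | eq | rel => simp [Fml.substAll, Term.subst_subst]
  | con A B hA hB | dis A B hA hB | imp A B hA hB => simp [Fml.substAll, hA, hB]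

theorem substAll_var (A : Fml L) : A.substAll Term.var = A := by
  induction A with
  | bot | all | ex => rfl
  | eq | rel => simp [Fml.substAll, Term.subst_var_eq]
  | con A B hA hB | dis A B hA hB | imp A B hA hB => simp [Fml.substAll, hA, hB]

theorem substAll_conjList (σ : ℕ → L.Term ℕ) (A : Fml L) (l : List (Fml L)) :
    (conjList A l).substAll σ = conjList (A.substAll σ) (l.map (substAll σ)) := by
  induction l generalizing A with
  | nil => rfl
  | cons B l ih => simp [conjList, substAll, ih]

theorem substAll_impList (σ : ℕ → L.Term ℕ) (l : List (Fml L)) (B : Fml L) :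
    (impList l B).substAll σ = impList (l.map (substAll σ)) (B.substAll σ) := by
  cases l with
  | nil => rfl
  | cons A l => simp [impList, substAll, substAll_conjList]

theorem QF.conjList {A : Fml L} {l : List (Fml L)} (hA : A.QF) (hl : ∀ B ∈ l, B.QF) :
    (conjList A l).QF := by
  induction l generalizing A with
  | nil => exact hA
  | cons B l ih => exact ⟨hA, ih (hl _ (by simp)) fun C hC => hl _ (by simp [hC])⟩

theorem QF.impList {B : Fml L} {l : List (Fml L)} (hl : ∀ A ∈ l, A.QF) (hB : B.QF) :
    (impList l B).QF := by
  cases l with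
  | nil => exact hB
  | cons A l => exact ⟨QF.conjList (hl _ (by simp)) fun C hC => hl _ (by simp [hC]), hB⟩

theorem fv_foldr_all (A : Fml L) (l : List ℕ) : (l.foldr all A).fv = A.fv \ l.toFinset := by
  induction l with
  | nil => simp
  | cons x l ih => ext y; simp [fv, ih]; grind

theorem fv_close (A : Fml L) : A.close.fv = ∅ := by
  simp [close, fv_foldr_all]

/-- Formulas over a countable signature form a countable set. -/
theorem countable [Countable L.Symbols] : Countable (Fml L) := by
  -- Induction on the bound: a formula of size at most n is one constructor applied to terms or to
  -- formulas of size below n, hence in the range of `g`, whose domain is countable.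
  have hdepth : ∀ n, {A : Fml L | A.size < n}.Countable := by
    intro n
    induction n with
    | zero => simp
    | succ n ih =>
      have := ih.to_subtype
      let T := {A : Fml L | A.size < n}
      have hT : Countable T := this
      let g : Unit ⊕ (L.Term ℕ × L.Term ℕ) ⊕ (Σ R : (Σ n, L.Relations n), (Fin R.1 → L.Term ℕ)) ⊕
          (T × T) ⊕ (T × T) ⊕ (T × T) ⊕ (ℕ × T) ⊕ (ℕ × T) → Fml L := fun a =>
        match a with
        | .inl _ => bot
        | .inr (.inl p) => eq p.1 p.2
        | .inr (.inr (.inl p)) => rel p.1.2 p.2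
        | .inr (.inr (.inr (.inl p))) => con p.1 p.2
        | .inr (.inr (.inr (.inr (.inl p)))) => dis p.1 p.2
        | .inr (.inr (.inr (.inr (.inr (.inl p))))) => imp p.1 p.2
        | .inr (.inr (.inr (.inr (.inr (.inr (.inl p)))))) => all p.1 p.2
        | .inr (.inr (.inr (.inr (.inr (.inr (.inr p)))))) => ex p.1 p.2
      have hrel : Countable (Σ n, L.Relations n) :=
        (Sum.inr_injective (α := Σ n, L.Functions n)).countable (f := Sum.inr)
      refine (Set.countable_range g).mono fun A hA => ?_
      simp only [Set.mem_ofPred_eq] at hA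
      cases A with
      | bot => exact ⟨.inl (), rfl⟩
      | eq s t => exact ⟨.inr (.inl (s, t)), rfl⟩
      | rel R ts => exact ⟨.inr (.inr (.inl ⟨⟨_, R⟩, ts⟩)), rfl⟩
      | con A B =>
        simp only [size] at hA
        exact ⟨.inr (.inr (.inr (.inl (⟨A, by simp [T]; omega⟩, ⟨B, by simp [T]; omega⟩)))), rfl⟩
      | dis A B =>
        simp only [size] at hA
        exact ⟨.inr (.inr (.inr (.inr (.inl
          (⟨A, by simp [T]; omega⟩, ⟨B, by simp [T]; omega⟩))))), rfl⟩
      | imp A B =>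
        simp only [size] at hA
        exact ⟨.inr (.inr (.inr (.inr (.inr (.inl
          (⟨A, by simp [T]; omega⟩, ⟨B, by simp [T]; omega⟩)))))), rfl⟩
      | all x A =>
        simp only [size] at hA
        exact ⟨.inr (.inr (.inr (.inr (.inr (.inr (.inl (x, ⟨A, by simp [T]; omega⟩))))))), rfl⟩
      | ex x A =>
        simp only [size] at hA
        exact ⟨.inr (.inr (.inr (.inr (.inr (.inr (.inr (x, ⟨A, by simp [T]; omega⟩))))))), rfl⟩
  rw [← Set.countable_univ_iff]
  refine (Set.countable_iUnion hdepth).mono fun A _ => ?_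
  exact Set.mem_iUnion.2 ⟨A.size + 1, Nat.lt_succ_self _⟩

end Fml

/-! ### Structural properties of derivations -/

namespace Deriv

open Fml FirstOrder.Language

variable {L : FirstOrder.Language.{u, v}} {W : Fml L → Prop} {Inst : ℕ → L.Term ℕ → Prop}
  {Ax Γ Δ : Set (Fml L)} {A B C : Fml L}

/-- The closure conditions that a notion of well-sortedness should satisfy. -/
structure Admissible (W : Fml L → Prop) (Inst : ℕ → L.Term ℕ → Prop) : Prop where
  con : ∀ {A B}, W (con A B) ↔ W A ∧ W B
  dis : ∀ {A B}, W (dis A B) ↔ W A ∧ W B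
  imp : ∀ {A B}, W (imp A B) ↔ W A ∧ W B
  all : ∀ {x A}, W (all x A) ↔ Inst x (vt x) ∧ W A
  var : ∀ {x t}, Inst x t → Inst x (vt x)
  subst : ∀ {x t A}, Inst x t → W A → W (subst x t A)

theorem admissible_true :
    Admissible (L := L) (fun _ => True) (fun _ _ => True) := by
  constructor <;> simp

/-- Each rule either checks `W` itself or inherits it from its premises; only `allE` needs closure
under substitution. -/
theorem wellSorted (h : Admissible W Inst) (d : Deriv W Inst Ax Γ A) : W A := by
  induction d with
  | assumption _ hW => exact hW
  | ax _ hW => exact hW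
  | weaken _ _ ih => exact ih
  | conI _ _ h1 h2 => exact h.con.2 ⟨h1, h2⟩
  | conE₁ _ ih => exact (h.con.1 ih).1
  | conE₂ _ ih => exact (h.con.1 ih).2
  | disI₁ hW _ ih => exact h.dis.2 ⟨ih, hW⟩
  | disI₂ hW _ ih => exact h.dis.2 ⟨hW, ih⟩
  | disE _ _ _ _ ih _ => exact ih
  | impI hW _ ih => exact h.imp.2 ⟨hW, ih⟩
  | impE _ _ ih _ => exact (h.imp.1 ih).2
  | botE hW _ _ => exact hW
  | raa hW _ _ => exact hW
  | allI _ hW _ _ => exact hW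
  | allE _ hI _ ih => exact h.subst hI (h.all.1 ih).2
  | exI _ _ hW _ _ => exact hW
  | exE _ _ _ _ _ ih => exact ih

theorem exists_finite (d : Deriv W Inst Ax Γ A) :
    ∃ Γ₀ ⊆ Γ, Γ₀.Finite ∧ Deriv W Inst Ax Γ₀ A := by
  -- For rules that discharge A: removing A from the finite set of a premise leaves assumptions in
  -- Γ, and A can be added back for the premise.
  have drop : ∀ {Γ Γ₁ : Set (Fml L)} {A B : Fml L}, Γ₁ ⊆ insert A Γ → Γ₁.Finite →
      Deriv W Inst Ax Γ₁ B → ∃ Γ₀ ⊆ Γ, Γ₀.Finite ∧ Deriv W Inst Ax (insert A Γ₀) B := by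
    intro Γ Γ₁ A B hs hf d
    refine ⟨Γ₁ \ {A}, by simpa [Set.sdiff_subset_iff] using hs, hf.subset Set.sdiff_subset,
      d.weaken fun C hC => ?_⟩
    by_cases e : C = A
    · exact Or.inl e
    · exact Or.inr ⟨hC, e⟩
  induction d with
  | @assumption Γ A hA hW => exact ⟨{A}, by simpa using hA, by simp, .assumption rfl hW⟩
  | ax hA hW => exact ⟨∅, by simp, by simp, .ax hA hW⟩
  | weaken hs _ ih =>
    obtain ⟨Γ₀, h1, h2, h3⟩ := ih
    exact ⟨Γ₀, h1.trans hs, h2, h3⟩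
  | conI _ _ ih1 ih2 =>
    obtain ⟨Γ₁, h1, h2, h3⟩ := ih1
    obtain ⟨Γ₂, k1, k2, k3⟩ := ih2
    exact ⟨Γ₁ ∪ Γ₂, Set.union_subset h1 k1, h2.union k2,
      .conI (h3.weaken Set.subset_union_left) (k3.weaken Set.subset_union_right)⟩
  | conE₁ _ ih =>
    obtain ⟨Γ₁, h1, h2, h3⟩ := ih
    exact ⟨Γ₁, h1, h2, .conE₁ h3⟩
  | conE₂ _ ih =>
    obtain ⟨Γ₁, h1, h2, h3⟩ := ih
    exact ⟨Γ₁, h1, h2, .conE₂ h3⟩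
  | disI₁ hW _ ih =>
    obtain ⟨Γ₁, h1, h2, h3⟩ := ih
    exact ⟨Γ₁, h1, h2, .disI₁ hW h3⟩
  | disI₂ hW _ ih =>
    obtain ⟨Γ₁, h1, h2, h3⟩ := ih
    exact ⟨Γ₁, h1, h2, .disI₂ hW h3⟩
  | disE _ _ _ ih1 ih2 ih3 =>
    obtain ⟨Γ₁, h1, h2, h3⟩ := ih1
    obtain ⟨Γ₂, k1, k2, k3⟩ := ih2
    obtain ⟨Γ₃, l1, l2, l3⟩ := ih3
    obtain ⟨Γ₂, k1, k2, k3⟩ := drop k1 k2 k3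
    obtain ⟨Γ₃, l1, l2, l3⟩ := drop l1 l2 l3
    refine ⟨Γ₁ ∪ (Γ₂ ∪ Γ₃), Set.union_subset h1 (Set.union_subset k1 l1),
      h2.union (k2.union l2), .disE (h3.weaken ?_) (k3.weaken ?_) (l3.weaken ?_)⟩
    · exact Set.subset_union_left
    · exact Set.insert_subset_insert (Set.subset_union_left.trans Set.subset_union_right)
    · exact Set.insert_subset_insert (Set.subset_union_right.trans Set.subset_union_right)
  | impI hW _ ih =>
    obtain ⟨Γ₁, h1, h2, h3⟩ := ih
    obtain ⟨Γ₁, h1, h2, h3⟩ := drop h1 h2 h3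
    exact ⟨Γ₁, h1, h2, .impI hW h3⟩
  | impE _ _ ih1 ih2 =>
    obtain ⟨Γ₁, h1, h2, h3⟩ := ih1
    obtain ⟨Γ₂, k1, k2, k3⟩ := ih2
    exact ⟨Γ₁ ∪ Γ₂, Set.union_subset h1 k1, h2.union k2,
      .impE (h3.weaken Set.subset_union_left) (k3.weaken Set.subset_union_right)⟩
  | botE hW _ ih =>
    obtain ⟨Γ₁, h1, h2, h3⟩ := ih
    exact ⟨Γ₁, h1, h2, .botE hW h3⟩
  | raa hW _ ih =>
    obtain ⟨Γ₁, h1, h2, h3⟩ := ih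
    obtain ⟨Γ₁, h1, h2, h3⟩ := drop h1 h2 h3
    exact ⟨Γ₁, h1, h2, .raa hW h3⟩
  | allI hx hW _ ih =>
    obtain ⟨Γ₁, h1, h2, h3⟩ := ih
    exact ⟨Γ₁, h1, h2, .allI (fun B hB => hx B (h1 hB)) hW h3⟩
  | allE hf hI _ ih =>
    obtain ⟨Γ₁, h1, h2, h3⟩ := ih
    exact ⟨Γ₁, h1, h2, .allE hf hI h3⟩
  | exI hf hI hW _ ih =>
    obtain ⟨Γ₁, h1, h2, h3⟩ := ih
    exact ⟨Γ₁, h1, h2, .exI hf hI hW h3⟩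
  | exE hx hC _ _ ih1 ih2 =>
    obtain ⟨Γ₁, h1, h2, h3⟩ := ih1
    obtain ⟨Γ₂, k1, k2, k3⟩ := ih2
    obtain ⟨Γ₂, k1, k2, k3⟩ := drop k1 k2 k3
    exact ⟨Γ₁ ∪ Γ₂, Set.union_subset_union h1 k1, h2.union k2,
      .exE (fun B hB => hx B (k1 hB)) hC h3 k3⟩

theorem weaken' (d : Deriv W Inst Ax Γ A) (h : Γ ⊆ Δ) : Deriv W Inst Ax Δ A :=
  .weaken h d

/-- Derivable assumptions may be omitted. -/
theorem cut (h : Admissible W Inst) (hΓ : ∀ B ∈ Γ, Deriv W Inst Ax Δ B)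
    (d : Deriv W Inst Ax (Γ ∪ Δ) A) : Deriv W Inst Ax Δ A := by
  obtain ⟨Γ₀, hs, hf, d⟩ := d.exists_finite
  -- Splicing derivations into d could violate eigenvariable conditions. Instead each of the
  -- finitely many assumptions is discharged into an implication and supplied by `impE`.
  have : ∀ Θ : Set (Fml L), Θ.Finite → Θ ⊆ Γ → ∀ A, Deriv W Inst Ax (Θ ∪ Δ) A →
      Deriv W Inst Ax Δ A := by
    intro Θ hΘ
    induction Θ, hΘ using Set.Finite.induction_on with
    | empty => intro _ A d; simpa using d
    | @insert B Θ _ _ ih =>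
      intro hs A d
      have hB := hΓ B (hs (by simp))
      have := ih ((Set.subset_insert _ _).trans hs) (Fml.imp B A)
        (.impI (hB.wellSorted h) (by simpa [Set.insert_union] using d))
      exact .impE this hB
  exact this (Γ₀ \ Δ) (hf.subset Set.sdiff_subset) (fun B hB => (hs hB.1).resolve_right hB.2) A
    (d.weaken' (by simp))

/-- Each quantifier is instantiated by its own variable, which is always free for itself. -/
theorem of_foldr_all (h : Admissible W Inst) {l : List ℕ}
    (d : Deriv W Inst Ax Γ (l.foldr all A)) : Deriv W Inst Ax Γ A := by
  induction l with
  | nil => exact d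
  | cons x l ih =>
    have hI := (h.all.1 (d.wellSorted h)).1
    have := d.allE (freeFor_vt_self x _) hI
    rw [subst_vt_self] at this
    exact ih this

/-- A formula follows from its universal closure. -/
theorem of_close (h : Admissible W Inst) (d : Deriv W Inst Ax Γ A.close) : Deriv W Inst Ax Γ A :=
  of_foldr_all h d

/-- Generalization followed by instantiation. -/
theorem subst_of (h : Admissible W Inst) {x : ℕ} {t : L.Term ℕ} (hx : ∀ B ∈ Γ, x ∉ B.fv)
    (hI : Inst x t) (hf : FreeFor x t A) (d : Deriv W Inst Ax Γ A) :
    Deriv W Inst Ax Γ (subst x t A) :=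
  .allE hf hI (.allI hx (h.all.2 ⟨h.var hI, d.wellSorted h⟩) d)

/-- Simultaneous substitution for generic variables that do not occur in the substituted terms. -/
theorem substAll_of (h : Admissible W Inst) {l : List ℕ} (hl : l.Nodup) {σ : ℕ → L.Term ℕ}
    (hx : ∀ x ∈ l, ∀ B ∈ Γ, x ∉ B.fv) (hI : ∀ x ∈ l, Inst x (σ x))
    (hσ : ∀ x ∈ l, ∀ y ∈ l, y ∉ (σ x).varFinset) (hσ' : ∀ x ∉ l, σ x = .var x)
    (hA : A.QF) (d : Deriv W Inst Ax Γ A) : Deriv W Inst Ax Γ (A.substAll σ) := by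
  induction l generalizing σ A with
  | nil =>
    have : σ = Term.var := funext fun x => hσ' x (by simp)
    rwa [this, substAll_var]
  | cons x l ih =>
    have hxl := (List.nodup_cons.1 hl).1
    -- One variable is replaced at a time. Successive and simultaneous substitution agree because no
    -- substituted term contains any of the variables; `σ` is reset at x for the remaining ones.
    have d' := subst_of h (hx x (by simp)) (hI x (by simp)) (hA.freeFor _ _) d
    rw [hA.subst_eq] at d'
    have ne : ∀ y ∈ l, y ≠ x := fun y hy e => hxl (e ▸ hy)
    have := ih (List.nodup_cons.1 hl).2 (σ := Function.update σ x (.var x))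
      (fun y hy => hx y (by simp [hy]))
      (fun y hy => by rw [Function.update_of_ne (ne y hy)]; exact hI y (by simp [hy]))
      (fun y hy z hz => by
        rw [Function.update_of_ne (ne y hy)]; exact hσ y (by simp [hy]) z (by simp [hz]))
      (fun y hy => by
        by_cases e : y = x
        · subst e; simp
        · rw [Function.update_of_ne e]; exact hσ' y (by simp [hy, e]))
      (hA.substAll _) d'
    rw [substAll_substAll] at this
    convert this using 2
    funext y
    by_cases e : y = x
    · subst e
      rw [Function.update_self]
      refine (Term.subst_eq_self fun z hz => ?_).symm
      by_cases e' : z = y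
      · subst e'; simp
      · rw [Function.update_of_ne e']
        refine hσ' z fun hzl => ?_
        exact hσ y (by simp) z hzl hz
    · simp [Function.update_of_ne e, Term.subst]

theorem of_impList {l : List (Fml L)} (d : Deriv W Inst Ax Γ (impList l B))
    (hl : ∀ A ∈ l, Deriv W Inst Ax Γ A) : Deriv W Inst Ax Γ B := by
  have hc : ∀ (l : List (Fml L)) (A : Fml L), Deriv W Inst Ax Γ A →
      (∀ A ∈ l, Deriv W Inst Ax Γ A) → Deriv W Inst Ax Γ (conjList A l) := by
    intro l
    induction l with
    | nil => exact fun A h _ => h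
    | cons B l ih => exact fun A h hl => .conI h (ih B (hl _ (by simp)) fun C hC => hl _ (by simp [hC]))
  cases l with
  | nil => exact d
  | cons A l => exact .impE d (hc l A (hl _ (by simp)) fun C hC => hl _ (by simp [hC]))

end Deriv

/-! ### Fresh variables and closure properties of well-sortedness -/

namespace ManySortedSignature

open Fml FirstOrder.Language

variable {L : FirstOrder.Language.{u, v}} {ι : Type w} (S : ManySortedSignature L ι)

theorem exists_fresh (F : Finset ℕ) {n : ℕ} (i : Fin n → ι) :
    ∃ x : Fin n → ℕ, Function.Injective x ∧ ∀ k, S.varSort (x k) = some (i k) ∧ x k ∉ F := by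
  induction n with
  | zero => exact ⟨Fin.elim0, fun k => k.elim0, fun k => k.elim0⟩
  | succ n ih =>
    obtain ⟨x, hx, hx'⟩ := ih (Fin.tail i)
    obtain ⟨y, hy, hy'⟩ := (S.varSort_infinite (i 0)).exists_notMem_finset
      (F ∪ Finset.univ.image x)
    simp only [Finset.mem_union, Finset.mem_image, Finset.mem_univ, true_and, not_or,
      not_exists] at hy'
    refine ⟨Fin.cons y x, Fin.cons_injective_iff.2 ⟨by rintro ⟨k, hk⟩; exact hy'.2 k hk, hx⟩,
      fun k => ?_⟩
    cases k using Fin.cases with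
    | zero => exact ⟨hy, hy'.1⟩
    | succ k => exact hx' k

/-- For all terms `t k` of sorts `i k` there are distinct variables `x k` of these sorts, and a
substitution `σ` of the terms for the variables, under which derivability is preserved. -/
theorem exists_generic.{u', v'} {L' : FirstOrder.Language.{u', v'}} {κ : Type*} [Finite κ]
    (t : κ → L'.Term ℕ) (i : κ → ι) :
    ∃ (x : κ → ℕ) (σ : ℕ → L'.Term ℕ), (∀ k, S.varSort (x k) = some (i k)) ∧
      (∀ k, σ (x k) = t k) ∧
      ∀ {W : Fml L' → Prop} {Inst : ℕ → L'.Term ℕ → Prop} {Ax Γ : Set (Fml L')} {A : Fml L'},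
        Deriv.Admissible W Inst → (∀ k, Inst (x k) (t k)) → (∀ k, ∀ B ∈ Γ, x k ∉ B.fv) → A.QF →
        Deriv W Inst Ax Γ A → Deriv W Inst Ax Γ (A.substAll σ) := by
  have := Fintype.ofFinite κ
  let e := Fintype.equivFin κ
  obtain ⟨x, hx, hx'⟩ := S.exists_fresh (Finset.univ.biUnion fun k => (t k).varFinset)
    (i ∘ e.symm)
  have hinj : Function.Injective (x ∘ e) := hx.comp e.injective
  have hext : ∀ k, Function.extend (x ∘ e) t Term.var (x (e k)) = t k :=
    fun k => hinj.extend_apply t _ k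
  refine ⟨x ∘ e, Function.extend (x ∘ e) t Term.var, fun k => by simp [hx'], hext, ?_⟩
  intro W Inst Ax Γ A h hI hΓ hA d
  refine d.substAll_of h (l := Finset.univ.toList.map (x ∘ e))
    ((Finset.nodup_toList _).map hinj) ?_ ?_ ?_ ?_ hA
  · simpa using hΓ
  · simp only [List.mem_map, Finset.mem_toList, Finset.mem_univ, true_and]
    rintro _ ⟨k, rfl⟩
    rw [Function.comp_apply, hext]
    exact hI k
  · simp only [List.mem_map, Finset.mem_toList, Finset.mem_univ, true_and]
    rintro _ ⟨k, rfl⟩ _ ⟨k', rfl⟩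
    rw [Function.comp_apply, hext]
    have := (hx' (e k')).2
    simp only [Finset.mem_biUnion, Finset.mem_univ, true_and, not_exists] at this
    exact this k
  · intro y hy
    refine Function.extend_apply' _ _ _ ?_
    rintro ⟨k, hk⟩
    exact hy (by simpa using ⟨k, hk⟩)

variable {S}

theorem HasSort.substTerm {x : ℕ} {t s : L.Term ℕ} {i j : ι} (hx : S.varSort x = some i)
    (ht : S.HasSort t i) (hs : S.HasSort s j) : S.HasSort (substTerm x t s) j := by
  induction hs with
  | @var y j hy =>
    by_cases e : y = x
    · subst e
      obtain rfl : i = j := Option.some_injective _ (hx.symm.trans hy)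
      simpa [Fml.substTerm, Term.subst] using ht
    · simpa [Fml.substTerm, Term.subst, e] using HasSort.var hy
  | func _ hf ih => exact .func ih hf

theorem WellSorted.subst {x : ℕ} {t : L.Term ℕ} {i : ι} {A : Fml L} (hx : S.varSort x = some i)
    (ht : S.HasSort t i) (hA : S.WellSorted A) : S.WellSorted (subst x t A) := by
  induction A with
  | bot => trivial
  | eq s r =>
    obtain ⟨j, h1, h2⟩ := hA
    exact ⟨j, ht.substTerm hx h1, ht.substTerm hx h2⟩
  | rel R ts =>
    obtain ⟨j, hj, h⟩ := hA
    exact ⟨j, hj, fun k => ht.substTerm hx (h k)⟩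
  | con A B h1 h2 | dis A B h1 h2 | imp A B h1 h2 => exact ⟨h1 hA.1, h2 hA.2⟩
  | all y A h | ex y A h =>
    by_cases e : y = x
    · simpa [Fml.subst, e] using e ▸ hA
    · simpa [Fml.subst, e] using ⟨hA.1, h hA.2⟩

theorem HasSort.exists_varSort {t : L.Term ℕ} {i : ι} (h : S.HasSort t i) {x : ℕ}
    (hx : x ∈ t.varFinset) : ∃ j, S.varSort x = some j := by
  induction h with
  | @var y i hy =>
    obtain rfl : x = y := by simpa [Term.varFinset] using hx
    exact ⟨i, hy⟩
  | func _ _ ih =>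
    simp only [Term.varFinset, Finset.mem_biUnion, Finset.mem_univ, true_and] at hx
    obtain ⟨k, hk⟩ := hx
    exact ih k hk

theorem WellSorted.exists_varSort {A : Fml L} (h : S.WellSorted A) {x : ℕ} (hx : x ∈ A.fv) :
    ∃ j, S.varSort x = some j := by
  induction A with
  | bot => simp [fv] at hx
  | eq s t =>
    obtain ⟨i, hs, ht⟩ := h
    exact (Finset.mem_union.1 hx).elim hs.exists_varSort ht.exists_varSort
  | rel R ts =>
    obtain ⟨i, -, h⟩ := h
    simp only [fv, Finset.mem_biUnion, Finset.mem_univ, true_and] at hx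
    obtain ⟨k, hk⟩ := hx
    exact (h k).exists_varSort hk
  | con A B h1 h2 | dis A B h1 h2 | imp A B h1 h2 =>
    exact (Finset.mem_union.1 hx).elim (h1 h.1) (h2 h.2)
  | all y A ih | ex y A ih => exact ih h.2 (Finset.mem_of_mem_erase hx)

/-- Free variables of a well-sorted formula have sorts, so the quantifiers of the closure are well
sorted. -/
theorem WellSorted.close {A : Fml L} (h : S.WellSorted A) : S.WellSorted A.close := by
  have key : ∀ l : List ℕ, (∀ y ∈ l, ∃ j, S.varSort y = some j) →
      S.WellSorted (l.foldr Fml.all A) := by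
    intro l
    induction l with
    | nil => exact fun _ => h
    | cons y l ih => exact fun h => ⟨h y (by simp), ih fun z hz => h z (by simp [hz])⟩
  exact key _ fun y hy => h.exists_varSort (by simpa using hy)

theorem WellSorted.impList {l : List (Fml L)} {B : Fml L} (hl : ∀ A ∈ l, S.WellSorted A)
    (hB : S.WellSorted B) : S.WellSorted (impList l B) := by
  have hc : ∀ (l : List (Fml L)) (A : Fml L), S.WellSorted A → (∀ B ∈ l, S.WellSorted B) →
      S.WellSorted (conjList A l) := by
    intro l
    induction l with
    | nil => exact fun A h _ => h
    | cons B l ih =>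
      exact fun A h hl => ⟨h, ih B (hl _ (by simp)) fun C hC => hl _ (by simp [hC])⟩
  cases l with
  | nil => exact hB
  | cons A l => exact ⟨hc l A (hl _ (by simp)) fun C hC => hl _ (by simp [hC]), hB⟩

variable (S)

theorem admissible :
    Deriv.Admissible S.WellSorted fun x t => ∃ i, S.varSort x = some i ∧ S.HasSort t i where
  con := Iff.rfl
  dis := Iff.rfl
  imp := Iff.rfl
  all := and_congr_left' ⟨fun ⟨i, h⟩ => ⟨i, h, .var h⟩, fun ⟨i, h, _⟩ => ⟨i, h⟩⟩
  var := fun ⟨i, h, _⟩ => ⟨i, h, .var h⟩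
  subst := fun ⟨_, h, ht⟩ hA => hA.subst h ht

end ManySortedSignature

/-! ### Translating many-sorted derivations into unsorted ones -/

namespace FOL

open Fml FirstOrder.Language

variable {L : FirstOrder.Language.{u, v}} {Γ : Set (Fml L)} {x y : ℕ}

theorem derives_symm (d : Derives Γ (eq (vt x) (vt y))) : Derives Γ (eq (vt y) (vt x)) :=
  .impE (.of_close Deriv.admissible_true (.ax (.symm x y) trivial)) d

theorem derives_trans {z : ℕ} (d : Derives Γ (eq (vt x) (vt y)))
    (d' : Derives Γ (eq (vt y) (vt z))) : Derives Γ (eq (vt x) (vt z)) :=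
  .impE (.of_close Deriv.admissible_true (.ax (.trans x y z) trivial)) (.conI d d')

end FOL

namespace ManySortedSignature

open Fml FirstOrder.Language

variable {L : FirstOrder.Language.{u, v}} {ι : Type w}

theorem varFinset_starTerm (t : L.withApprox.Term ℕ) :
    (starTerm ι t).varFinset = t.varFinset := by
  induction t with
  | var x => rfl
  | func f ts ih => simp [starTerm, Term.varFinset, ih]

theorem starTerm_subst (s : L.withApprox.Term ℕ) (σ : ℕ → L.withApprox.Term ℕ) :
    starTerm ι (s.subst σ) = (starTerm ι s).subst fun x => starTerm ι (σ x) := by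
  induction s with
  | var x => rfl
  | func f ts ih => simp [starTerm, Term.subst, ih]

theorem starTerm_substTerm (x : ℕ) (t s : L.withApprox.Term ℕ) :
    starTerm ι (substTerm x t s) = substTerm x (starTerm ι t) (starTerm ι s) := by
  rw [substTerm, substTerm, starTerm_subst]
  refine Term.subst_congr fun y _ => ?_
  by_cases e : y = x
  · subst e; simp
  · simp [e, starTerm]

theorem substTerm_vt_of_ne {L : FirstOrder.Language.{u, v}} {x y : ℕ} (h : y ≠ x)
    (t : L.Term ℕ) : substTerm x t (vt y) = vt y := by
  simp [substTerm, Term.subst, h]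

theorem subst_sortPred (x : ℕ) (t s : (L.withSorts ι).Term ℕ) (i : ι) :
    subst x t (sortPred i s) = sortPred i (substTerm x t s) := by
  simp only [sortPred, Fml.subst]
  congr 1
  funext k
  simp

theorem substAll_sortPred (σ : ℕ → (L.withSorts ι).Term ℕ) (s : (L.withSorts ι).Term ℕ) (i : ι) :
    substAll σ (sortPred i s) = sortPred i (s.subst σ) := by
  simp only [sortPred, substAll]
  congr 1
  funext k
  simp

theorem qf_sortPred (t : (L.withSorts ι).Term ℕ) (i : ι) : (sortPred i t).QF :=
  trivial

theorem fv_sortPred (t : (L.withSorts ι).Term ℕ) (i : ι) :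
    (sortPred i t).fv = t.varFinset := by
  ext; simp [sortPred, fv]

variable (S : ManySortedSignature L ι)

/-- Relativization mentions Q_i x only directly under the quantifier that binds x. -/
theorem fv_star (A : Fml L.withApprox) : (S.star A).fv = A.fv := by
  induction A with
  | bot => rfl
  | eq s t => simp [star, fv, varFinset_starTerm]
  | rel R ts =>
    cases R with
    | base R => simp [star, starRel, fv, varFinset_starTerm]
    | approx => ext; simp [star, starRel, fv, varFinset_starTerm]
  | con A B h1 h2 | dis A B h1 h2 | imp A B h1 h2 => simp [star, fv, h1, h2]
  | all x A h | ex x A h =>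
    simp only [star]
    split
    · ext y
      simp only [fv, fv_sortPred, h, Finset.mem_erase, Finset.mem_union, Term.varFinset,
        Finset.mem_singleton]
      grind
    · simp [fv, h]

theorem star_subst (x : ℕ) (t : L.withApprox.Term ℕ) (A : Fml L.withApprox) :
    S.star (subst x t A) = subst x (starTerm ι t) (S.star A) := by
  induction A with
  | bot => rfl
  | eq s r => simp [star, subst, starTerm_substTerm]
  | rel R ts =>
    cases R with
    | base R => simp [star, starRel, subst, starTerm_substTerm]
    | approx => simp [star, starRel, subst, starTerm_substTerm]
  | con A B h1 h2 | dis A B h1 h2 | imp A B h1 h2 => simp [star, subst, h1, h2]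
  | all y A h | ex y A h =>
    by_cases e : y = x
    · simp only [subst, e, if_true, star]
      split <;> simp [subst]
    · simp only [subst, e, if_false, star]
      split <;> simp [subst, e, h, subst_sortPred, substTerm_vt_of_ne e]

theorem freeFor_star {x : ℕ} {t : L.withApprox.Term ℕ} {A : Fml L.withApprox}
    (h : FreeFor x t A) : FreeFor x (starTerm ι t) (S.star A) := by
  induction A with
  | bot | eq => trivial
  | rel R ts => cases R <;> trivial
  | con A B h1 h2 | dis A B h1 h2 | imp A B h1 h2 => exact ⟨h1 h.1, h2 h.2⟩
  | all y A ih | ex y A ih =>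
    rcases h with h | ⟨h, h'⟩
    · rw [← S.fv_star] at h
      simp only [star] at h ⊢
      split at h <;> exact Or.inl h
    · simp only [star]
      rw [← varFinset_starTerm (ι := ι)] at h
      split
      · exact Or.inr ⟨h, trivial, ih h'⟩
      · exact Or.inr ⟨h, ih h'⟩

theorem star_impList (l : List (Fml L.withApprox)) (B : Fml L.withApprox) :
    S.star (impList l B) = impList (l.map S.star) (S.star B) := by
  have hc : ∀ (l : List (Fml L.withApprox)) (A : Fml L.withApprox),
      S.star (conjList A l) = conjList (S.star A) (l.map S.star) := by
    intro l
    induction l with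
    | nil => exact fun _ => rfl
    | cons B l ih => exact fun A => by simp [conjList, star, ih]
  cases l with
  | nil => rfl
  | cons A l => simp [impList, star, hc]

theorem fv_sortAx {B : Fml (L.withSorts ι)} (h : B ∈ S.SortAx) : B.fv = ∅ := by
  cases h with
  | nonempty x i => simp [fv, fv_sortPred, Term.varFinset]
  | func x h => exact fv_close _

/-- The assumptions `Q_i x` for all variables `x` of sort `i`. -/
def sortHyps : Set (Fml (L.withSorts ι)) :=
  {B | ∃ x i, S.varSort x = some i ∧ B = sortPred i (vt x)}

theorem derives_sortPred {t : L.withApprox.Term ℕ} {i : ι} (h : S.withApprox.HasSort t i) :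
    FOL.Derives (S.SortAx ∪ S.sortHyps) (sortPred i (starTerm ι t)) := by
  induction h with
  | var h => exact .assumption (Or.inr ⟨_, _, h, rfl⟩) trivial
  | @func n f ts i j h1 h2 ih =>
    obtain ⟨x, σ, hx, hσ, H⟩ := S.exists_generic (fun k => starTerm ι (ts k)) i
    -- The instance is formed from J alone, whose formulas are closed: under `sortHyps` no sorted
    -- variable could be generalized.
    have d : FOL.Derives S.SortAx
        (impList (List.ofFn fun k => sortPred (i k) (vt (x k)))
          (sortPred j (.func (f : L.Functions n) fun k => vt (x k)))) :=
      .of_close Deriv.admissible_true (.assumption (SortAx.func x h2) trivial)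
    have d := H Deriv.admissible_true (fun _ => trivial)
      (fun k B hB => by simp [S.fv_sortAx hB])
      (QF.impList (by simp [List.mem_ofFn, qf_sortPred]) (qf_sortPred _ _)) d
    rw [substAll_impList, List.map_ofFn] at d
    have := (d.weaken' (Δ := S.SortAx ∪ S.sortHyps) Set.subset_union_left).of_impList (by
      simp only [List.mem_ofFn]
      rintro _ ⟨k, rfl⟩
      rw [Function.comp_apply, substAll_sortPred, Term.subst, hσ]
      exact ih k)
    simp only [substAll_sortPred, Term.subst, hσ] at this
    exact this

theorem sort_mem_sortHyps {B : Fml (L.withSorts ι)} {x : ℕ} (hB : B ∈ S.sortHyps)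
    (hx : x ∈ B.fv) : ∃ i, S.varSort x = some i ∧ B = sortPred i (vt x) := by
  obtain ⟨y, i, h, rfl⟩ := hB
  obtain rfl : x = y := by simpa [fv_sortPred, Term.varFinset] using hx
  exact ⟨i, h, rfl⟩

/-- Only one sort assumption mentions x, namely Q_i x. Discharging it produces the relativized
implication and frees x for generalization. -/
theorem derives_star_all {Γ : Set (Fml (L.withSorts ι))} {x : ℕ} {A : Fml L.withApprox}
    (hx : ∀ B ∈ Γ, x ∉ B.fv) (d : FOL.Derives (Γ ∪ S.sortHyps) (S.star A)) :
    FOL.Derives (Γ ∪ S.sortHyps) (S.star (all x A)) := by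
  simp only [star]
  split
  · next i hi =>
    have d : FOL.Derives (Γ ∪ (S.sortHyps \ {sortPred i (vt x)}))
        (imp (sortPred i (vt x)) (S.star A)) := by
      refine .impI trivial (d.weaken' ?_)
      rintro B (hB | hB)
      · exact Or.inr (Or.inl hB)
      · by_cases e : B = sortPred i (vt x)
        · exact Or.inl e
        · exact Or.inr (Or.inr ⟨hB, e⟩)
    refine (Deriv.allI ?_ trivial d).weaken'
      (Set.union_subset_union_right _ Set.sdiff_subset)
    rintro B (hB | ⟨hB, hB'⟩) hxB
    · exact hx B hB hxB
    · obtain ⟨j, hj, rfl⟩ := S.sort_mem_sortHyps hB hxB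
      obtain rfl : i = j := Option.some_injective _ (hi.symm.trans hj)
      exact hB' rfl
  · next hi =>
    refine .allI ?_ trivial d
    rintro B (hB | hB) hxB
    · exact hx B hB hxB
    · obtain ⟨j, hj, -⟩ := S.sort_mem_sortHyps hB hxB
      simp [hi] at hj

theorem derives_star_close {A : Fml L.withApprox}
    (d : FOL.Derives (S.SortAx ∪ S.sortHyps) (S.star A)) :
    FOL.Derives (S.SortAx ∪ S.sortHyps) (S.star A.close) := by
  rw [close]
  generalize A.fv.sort (· ≤ ·) = l
  induction l with
  | nil => exact d
  | cons x l ih => exact S.derives_star_all (fun B hB => by simp [S.fv_sortAx hB]) ih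

theorem derives_star_eqAx {A : Fml L.withApprox} (h : A ∈ S.withApprox.EqAx) :
    FOL.Derives (S.SortAx ∪ S.sortHyps) (S.star A) := by
  have of_ax : ∀ {A : Fml (L.withSorts ι)}, A.close ∈ FOL.EqAx (L.withSorts ι) →
      FOL.Derives (S.SortAx ∪ S.sortHyps) A :=
    fun h => .of_close Deriv.admissible_true (.ax h trivial)
  cases h with
  | refl => exact S.derives_star_close (of_ax (.refl _))
  | symm => exact S.derives_star_close (of_ax (.symm _ _))
  | trans => exact S.derives_star_close (of_ax (.trans _ _ _))
  | @rel n R i x y hi hx hy =>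
    refine S.derives_star_close ?_
    rw [star_impList, List.map_ofFn]
    cases R with
    | base R => exact of_ax (.rel (L := L.withSorts ι) (StarRel.base R) x y)
    -- Strict congruence for the symbol ≈ becomes x₀ = y₀ ∧ x₁ = y₁ → (x₀ = x₁ → y₀ = y₁), which
    -- follows from symmetry and transitivity.
    | approx =>
      simp only [List.ofFn_succ, List.ofFn_zero, impList, conjList, Function.comp_apply, star,
        starRel, starTerm]
      refine .impI trivial (.impI trivial ?_)
      have h0 : FOL.Derives _ _ := .assumption (W := fun _ => True) (Inst := fun _ _ => True)
        (Ax := FOL.EqAx (L.withSorts ι)) (Γ := insert (eq (vt (x 0)) (vt (x 1)))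
          (insert (con (eq (vt (x 0)) (vt (y 0))) (eq (vt (x 1)) (vt (y 1))))
            (S.SortAx ∪ S.sortHyps))) (Or.inr (Or.inl rfl)) trivial
      exact FOL.derives_trans (FOL.derives_symm (.conE₁ h0))
        (FOL.derives_trans (.assumption (Or.inl rfl) trivial) (.conE₂ h0))
  | func =>
    refine S.derives_star_close ?_
    rw [star_impList, List.map_ofFn]
    exact of_ax (.func (L := L.withSorts ι) _ _ _)

/-- Once ≈ is read as =, the liberal axioms are unsorted equality axioms up to relativized closure,
and the two axioms linking = and ≈ become A → A. -/
theorem derives_star_approxAx {A : Fml L.withApprox} (h : A ∈ S.ApproxAx) :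
    FOL.Derives (S.SortAx ∪ S.sortHyps) (S.star A) := by
  have of_ax : ∀ {A : Fml (L.withSorts ι)}, A.close ∈ FOL.EqAx (L.withSorts ι) →
      FOL.Derives (S.SortAx ∪ S.sortHyps) A :=
    fun h => .of_close Deriv.admissible_true (.ax h trivial)
  cases h with
  | refl => exact S.derives_star_close (of_ax (.refl _))
  | symm => exact S.derives_star_close (of_ax (.symm _ _))
  | trans => exact S.derives_star_close (of_ax (.trans _ _ _))
  | @rel n R i j x y =>
    refine S.derives_star_close ?_
    rw [star_impList, List.map_ofFn]
    exact of_ax (.rel (L := L.withSorts ι) (StarRel.base R) x y)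
  | func =>
    refine S.derives_star_close ?_
    rw [star_impList, List.map_ofFn]
    exact of_ax (.func (L := L.withSorts ι) _ _ _)
  | of_eq | to_eq =>
    exact S.derives_star_close (.impI trivial (.assumption (Or.inl rfl) trivial))

/-- The translation of a many-sorted derivation, with sort assumptions for the variables. -/
theorem derives_star {Γ : Set (Fml L.withApprox)} {A : Fml L.withApprox}
    (d : S.withApprox.Derives Γ A) :
    FOL.Derives (S.star '' Γ ∪ (S.SortAx ∪ S.sortHyps)) (S.star A) := by
  have hins : ∀ (Γ : Set (Fml L.withApprox)) (A : Fml L.withApprox),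
      S.star '' (insert A Γ) ∪ (S.SortAx ∪ S.sortHyps) =
        insert (S.star A) (S.star '' Γ ∪ (S.SortAx ∪ S.sortHyps)) := by
    intro Γ A
    rw [Set.image_insert_eq, Set.insert_union]
  have hfv : ∀ {Γ : Set (Fml L.withApprox)} {x : ℕ}, (∀ B ∈ Γ, x ∉ B.fv) →
      ∀ B ∈ S.star '' Γ ∪ S.SortAx, x ∉ B.fv := by
    rintro Γ x h _ (⟨B, hB, rfl⟩ | hB)
    · rw [fv_star]; exact h B hB
    · simp [S.fv_sortAx hB]
  have hpred : ∀ {t : L.withApprox.Term ℕ} {i : ι}, S.withApprox.HasSort t i →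
      ∀ Γ : Set (Fml L.withApprox),
        FOL.Derives (S.star '' Γ ∪ (S.SortAx ∪ S.sortHyps)) (sortPred i (starTerm ι t)) :=
    fun h Γ => (S.derives_sortPred h).weaken' Set.subset_union_right
  induction d with
  | assumption h _ => exact .assumption (Or.inl ⟨_, h, rfl⟩) trivial
  | ax h _ => exact (S.derives_star_eqAx h).weaken' Set.subset_union_right
  | weaken h _ ih => exact ih.weaken' (Set.union_subset_union_left _ (Set.image_mono h))
  | conI _ _ h1 h2 => exact .conI h1 h2
  | conE₁ _ ih => exact .conE₁ ih
  | conE₂ _ ih => exact .conE₂ ih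
  | disI₁ _ _ ih => exact .disI₁ trivial ih
  | disI₂ _ _ ih => exact .disI₂ trivial ih
  | disE _ _ _ h1 h2 h3 =>
    rw [hins] at h2 h3
    exact .disE h1 h2 h3
  | impI _ _ ih =>
    rw [hins] at ih
    exact .impI trivial ih
  | impE _ _ h1 h2 => exact .impE h1 h2
  | botE _ _ ih => exact .botE trivial ih
  | raa _ _ ih =>
    rw [hins] at ih
    exact .raa trivial ih
  | allI hx _ _ ih =>
    rw [← Set.union_assoc] at ih ⊢
    exact S.derives_star_all (hfv hx) ih
  | @allE Γ x A t hf hI _ ih =>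
    obtain ⟨i, hi, ht⟩ := hI
    replace hi : S.varSort x = some i := hi
    simp only [star, hi] at ih
    have := Deriv.allE (A := imp (sortPred i (vt x)) (S.star A)) (t := starTerm ι t)
      ⟨trivial, S.freeFor_star hf⟩ trivial ih
    simp only [subst, subst_sortPred] at this
    rw [star_subst]
    refine this.impE ?_
    simpa [substTerm, Term.subst, FOL.Derives] using hpred ht Γ
  | @exI Γ x A t hf hI _ _ ih =>
    obtain ⟨i, hi, ht⟩ := hI
    replace hi : S.varSort x = some i := hi
    simp only [star, hi]
    refine .exI (t := starTerm ι t) ⟨trivial, S.freeFor_star hf⟩ trivial trivial ?_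
    simp only [subst, subst_sortPred]
    rw [← star_subst]
    refine .conI ?_ ih
    simpa [substTerm, Term.subst, FOL.Derives] using hpred ht Γ
  | @exE Γ Δ x A C hx hC d _ ih1 ih2 =>
    obtain ⟨⟨i, hi⟩, -⟩ : S.withApprox.WellSorted (ex x A) :=
      d.wellSorted S.withApprox.admissible
    replace hi : S.varSort x = some i := hi
    simp only [star, hi] at ih1
    rw [hins] at ih2
    -- The eigenvariable condition forces Q_i x out of the side assumptions; it is recovered below
    -- from the conjunction Q_i x ∧ A^* that is being eliminated.
    have hrest : ∀ B ∈ S.star '' Δ ∪ (S.SortAx ∪ (S.sortHyps \ {sortPred i (vt x)})),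
        x ∉ B.fv := by
      rintro B (hB | hB | ⟨hB, hB'⟩) hxB
      · exact hfv hx B (Or.inl hB) hxB
      · exact hfv hx B (Or.inr hB) hxB
      · obtain ⟨j, hj, rfl⟩ := S.sort_mem_sortHyps hB hxB
        obtain rfl : i = j := Option.some_injective _ (hi.symm.trans hj)
        exact hB' rfl
    refine (Deriv.exE hrest (by rwa [fv_star]) ih1 (?_ : Deriv _ _ _ _ _)).weaken' ?_
    · refine Deriv.cut (Γ := {sortPred i (vt x), S.star A}) Deriv.admissible_true ?_
        (ih2.weaken' ?_)
      · have h : FOL.Derives (insert (con (sortPred i (vt x)) (S.star A))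
          (S.star '' Δ ∪ (S.SortAx ∪ (S.sortHyps \ {sortPred i (vt x)}))))
          (con (sortPred i (vt x)) (S.star A)) := .assumption (Or.inl rfl) trivial
        rintro B (rfl | rfl)
        · exact .conE₁ h
        · exact .conE₂ h
      · rintro B (rfl | hB | hB | hB)
        · exact Or.inl (Or.inr rfl)
        · exact Or.inr (Or.inr (Or.inl hB))
        · exact Or.inr (Or.inr (Or.inr (Or.inl hB)))
        · by_cases e : B = sortPred i (vt x)
          · exact Or.inl (Or.inl e)
          · exact Or.inr (Or.inr (Or.inr (Or.inr ⟨hB, e⟩)))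
    · rw [Set.image_union]
      rintro B ((h | h) | (h | (h | h)))
      · exact Or.inl (Or.inl h)
      · exact Or.inr h
      · exact Or.inl (Or.inr h)
      · exact Or.inr (Or.inl h)
      · exact Or.inr (Or.inr h.1)

/-- The sort assumptions can be discharged, since no sort is empty. -/
theorem derives_of_sortHyps {Γ : Set (Fml (L.withSorts ι))} {A : Fml (L.withSorts ι)}
    (hΓ : ∀ B ∈ Γ, B.fv = ∅) (hA : A.fv = ∅)
    (d : FOL.Derives (Γ ∪ (S.SortAx ∪ S.sortHyps)) A) : FOL.Derives (Γ ∪ S.SortAx) A := by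
  rw [← Set.union_assoc] at d
  obtain ⟨Γ₀, hs, hf, d⟩ := d.exists_finite
  have key : ∀ Θ : Set (Fml (L.withSorts ι)), Θ.Finite → Θ ⊆ S.sortHyps →
      FOL.Derives (Γ ∪ S.SortAx ∪ Θ) A → FOL.Derives (Γ ∪ S.SortAx) A := by
    intro Θ hΘ
    induction Θ, hΘ using Set.Finite.induction_on with
    | empty => intro _ d; simpa using d
    | @insert B Θ hB _ ih =>
      intro hs d
      refine ih ((Set.subset_insert _ _).trans hs) ?_
      obtain ⟨x, i, hx, rfl⟩ := hs (Set.mem_insert _ _)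
      -- ∃E on this axiom removes Q_i x: x is not free in the remaining assumptions, since a
      -- variable has at most one sort.
      have d₀ : FOL.Derives (Γ ∪ S.SortAx) (ex x (sortPred i (vt x))) :=
        .assumption (Or.inr (.nonempty x i)) trivial
      refine (Deriv.exE (Δ := Γ ∪ S.SortAx ∪ Θ) ?_ (by simp [hA]) d₀
        (d.weaken' (by rw [Set.union_insert]))).weaken'
        (Set.union_subset Set.subset_union_left le_rfl)
      rintro C ((hC | hC) | hC)
      · simp [hΓ C hC]
      · simp [S.fv_sortAx hC]
      · intro hxC
        obtain ⟨j, hj, rfl⟩ := S.sort_mem_sortHyps (hs (Or.inr hC)) hxC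
        obtain rfl : i = j := Option.some_injective _ (hx.symm.trans hj)
        exact hB hC
  refine key (Γ₀ \ (Γ ∪ S.SortAx)) (hf.subset Set.sdiff_subset) ?_ (d.weaken' (by simp))
  exact fun B hB => (hs hB.1).resolve_left hB.2

theorem derives_star_of_derivesApprox {Γ : Set (Fml L.withApprox)} {φ : Fml L.withApprox}
    (hΓ : ∀ ψ ∈ Γ, ψ.fv = ∅) (hφ : φ.fv = ∅) (d : S.DerivesApprox Γ φ) :
    FOL.Derives (S.star '' Γ ∪ S.SortAx) (S.star φ) := by
  refine S.derives_of_sortHyps ?_ (by rwa [fv_star]) ?_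
  · rintro _ ⟨ψ, hψ, rfl⟩
    rw [fv_star, hΓ ψ hψ]
  · have d := S.derives_star d
    rw [Set.image_union, Set.union_comm (S.star '' Γ), Set.union_assoc] at d
    -- The translated Eq^≈ axioms are cut away, being derivable.
    refine Deriv.cut Deriv.admissible_true ?_ d
    rintro _ ⟨ψ, hψ, rfl⟩
    exact (S.derives_star_approxAx hψ).weaken' Set.subset_union_right

end ManySortedSignature

/-! ### Henkin sets with variables as witnesses -/

namespace ManySortedSignature

open Fml FirstOrder.Language

variable {L : FirstOrder.Language.{u, v}} {ι : Type w} (S : ManySortedSignature L ι)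
  {Γ U : Set (Fml L)} {A B : Fml L} {x : ℕ}

/-- Complete consistent sets of formulas in which every existential formula has infinitely many
witnessing variables. -/
structure IsHenkin (U : Set (Fml L)) : Prop where
  consistent : ¬ S.Derives U bot
  complete : ∀ {A}, S.WellSorted A → S.Derives U A ∨ S.Derives U (neg A)
  witness : ∀ {x A}, S.Derives U (ex x A) → ∀ N, ∃ y ≥ N, S.varSort y = S.varSort x ∧
    y ∉ A.vars ∧ S.Derives U (subst x (vt y) A)

variable {S}

theorem Derives.wellSorted (d : S.Derives Γ A) : S.WellSorted A :=
  Deriv.wellSorted S.admissible d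

/-- ∃E uses the bound variable itself as eigenvariable, so ∃x A is first renamed to ∃y A[y/x]. A
contradiction from the witness A[y/x] is then one from Γ by ∃E, y being fresh. -/
theorem consistent_insert_witness (hΓ : ¬ S.Derives Γ bot) (hA : S.WellSorted (ex x A))
    (hmem : ex x A ∈ Γ) {y : ℕ} (hyx : S.varSort y = S.varSort x) (hy : y ∉ (ex x A).vars)
    (hyΓ : ∀ B ∈ Γ, y ∉ B.fv) : ¬ S.Derives (insert (subst x (vt y) A) Γ) bot := by
  intro d
  obtain ⟨⟨i, hi⟩, hA'⟩ := hA
  simp only [vars, Finset.mem_insert, not_or] at hy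
  have hi' : S.varSort y = some i := hyx.trans hi
  have hw : S.WellSorted (ex y (subst x (vt y) A)) := ⟨⟨i, hi'⟩, hA'.subst hi (.var hi')⟩
  have dA : S.Derives (insert A ∅) (ex y (subst x (vt y) A)) := by
    refine .exI (freeFor_subst_vt hy.2) ⟨i, hi', .var hi⟩ hw ?_
    rw [subst_subst_vt hy.2]
    exact .assumption (Or.inl rfl) hA'
  have dx : S.Derives (Γ ∪ ∅) (ex y (subst x (vt y) A)) := by
    refine .exE (by simp) ?_ (.assumption hmem ⟨⟨i, hi⟩, hA'⟩) dA
    have : x ∉ (subst x (vt y) A).fv :=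
      notMem_fv_subst (by simpa [Term.varFinset] using Ne.symm hy.1) A
    simp [fv, this]
  refine hΓ ((Deriv.exE hyΓ (by simp [fv]) dx d).weaken' (by simp))

/-- Either ¬A is already derivable, or A can be added consistently, along with a witness if A is
existential. As T is closed and D finite, all but finitely many variables of the required sort are
fresh. -/
theorem exists_henkin_step {T D : Set (Fml L)} (hT : ∀ B ∈ T, B.fv = ∅) (hD : D.Finite)
    (hc : ¬ S.Derives (T ∪ D) bot) (N : ℕ) (A : Fml L) :
    ∃ D', (D'.Finite ∧ ¬ S.Derives (T ∪ D') bot) ∧ D ⊆ D' ∧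
      (S.WellSorted A → S.Derives (T ∪ D') (neg A) ∨ A ∈ D' ∧ ∀ x B, A = ex x B →
        ∃ y ≥ N, S.varSort y = S.varSort x ∧ y ∉ B.vars ∧ subst x (vt y) B ∈ D') := by
  by_cases hW : S.WellSorted A
  swap
  · exact ⟨D, ⟨hD, hc⟩, le_rfl, fun h => (hW h).elim⟩
  by_cases hA : S.Derives (insert A (T ∪ D)) bot
  · exact ⟨D, ⟨hD, hc⟩, le_rfl, fun _ => Or.inl (.impI hW hA)⟩
  by_cases hex : ∃ x B, A = ex x B
  · obtain ⟨x, B, rfl⟩ := hex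
    obtain ⟨i, hi⟩ := hW.1
    obtain ⟨y, hy, hy'⟩ := (S.varSort_infinite i).exists_notMem_finset
      (Finset.range N ∪ (ex x B).vars ∪ hD.toFinset.biUnion fv)
    simp only [Finset.mem_union, Finset.mem_range, Finset.mem_biUnion, Set.Finite.mem_toFinset,
      not_or, not_exists, not_and, not_lt] at hy'
    have hyx : S.varSort y = S.varSort x := Eq.trans hy hi.symm
    refine ⟨insert (subst x (vt y) B) (insert (ex x B) D), ⟨(hD.insert _).insert _, ?_⟩,
      (Set.subset_insert _ _).trans (Set.subset_insert _ _), fun _ => Or.inr ⟨by simp, ?_⟩⟩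
    · rw [Set.union_insert, Set.union_insert]
      refine consistent_insert_witness hA hW (by simp) hyx hy'.1.2 ?_
      rintro C (rfl | hC | hC)
      · exact fun h => hy'.1.2 (fv_subset_vars _ h)
      · simp [hT C hC]
      · exact hy'.2 C hC
    · rintro x' B' e
      obtain ⟨rfl, rfl⟩ : x = x' ∧ B = B' := by simpa using e
      refine ⟨y, hy'.1.1, hyx, fun h => hy'.1.2 ?_, by simp⟩
      simp [vars, h]
  · refine ⟨insert A D, ⟨hD.insert _, by rwa [Set.union_insert]⟩, Set.subset_insert _ _,
      fun _ => Or.inr ⟨by simp, fun x B e => (hex ⟨x, B, e⟩).elim⟩⟩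

theorem exists_isHenkin {T : Set (Fml L)} (hT : ∀ B ∈ T, B.fv = ∅) (hc : ¬ S.Derives T bot) :
    ∃ U, T ⊆ U ∧ S.IsHenkin U := by
  have := S.symbols_countable
  have := Fml.countable (L := L)
  have : Nonempty (Fml L) := ⟨bot⟩
  obtain ⟨g, hg⟩ := exists_surjective_nat (Fml L)
  -- Every formula recurs at arbitrarily late stages, and stage n picks witnesses y ≥ n; hence there
  -- are witnesses beyond every bound.
  let e : ℕ → Fml L := fun n => g n.unpair.1
  have he : ∀ A N, ∃ n ≥ N, e n = A := by
    intro A N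
    obtain ⟨m, rfl⟩ := hg A
    exact ⟨Nat.pair m N, Nat.right_le_pair m N, by simp [e]⟩
  let X := {D : Set (Fml L) // D.Finite ∧ ¬ S.Derives (T ∪ D) bot}
  have step : ∀ (n : ℕ) (D : X), ∃ D' : X, D.1 ⊆ D'.1 ∧
      (S.WellSorted (e n) → S.Derives (T ∪ D'.1) (neg (e n)) ∨ e n ∈ D'.1 ∧ ∀ x B, e n = ex x B →
        ∃ y ≥ n, S.varSort y = S.varSort x ∧ y ∉ B.vars ∧ subst x (vt y) B ∈ D'.1) := by
    intro n D
    obtain ⟨D', h1, h2⟩ := exists_henkin_step hT D.2.1 D.2.2 n (e n)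
    exact ⟨⟨D', h1⟩, h2⟩
  choose next hnext hnext' using step
  let D : ℕ → X := fun n => Nat.rec ⟨∅, by simp, by simpa using hc⟩ next n
  have hD : ∀ n, D (n + 1) = next n (D n) := fun n => rfl
  have hmono : Monotone fun n => (D n).1 := monotone_nat_of_le_succ fun n => hnext n (D n)
  have hsub : ∀ n, T ∪ (D n).1 ⊆ T ∪ ⋃ n, (D n).1 := fun n =>
    Set.union_subset_union_right _ (Set.subset_iUnion (fun n => (D n).1) n)
  have hcons : ¬ S.Derives (T ∪ ⋃ n, (D n).1) bot := by
    intro d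
    obtain ⟨Γ₀, hs, hf, d⟩ := Deriv.exists_finite d
    -- The stages increase, so a finite set of assumptions lies in a single one.
    have : ∃ n, Γ₀ ⊆ T ∪ (D n).1 := by
      clear d
      induction Γ₀, hf using Set.Finite.induction_on with
      | empty => exact ⟨0, by simp⟩
      | @insert B Γ₀ _ _ ih =>
        obtain ⟨n, hn⟩ := ih ((Set.subset_insert _ _).trans hs)
        rcases hs (Set.mem_insert _ _) with h | h
        · exact ⟨n, Set.insert_subset (Or.inl h) hn⟩
        · obtain ⟨m, hm⟩ := Set.mem_iUnion.1 h
          refine ⟨max n m, Set.insert_subset (Or.inr (hmono (le_max_right n m) hm)) ?_⟩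
          exact hn.trans (Set.union_subset_union_right _ (hmono (le_max_left n m)))
    obtain ⟨n, hn⟩ := this
    exact (D n).2.2 (d.weaken' hn)
  refine ⟨T ∪ ⋃ n, (D n).1, Set.subset_union_left, hcons, ?_, ?_⟩
  · intro A hA
    obtain ⟨n, -, rfl⟩ := he A 0
    rcases hnext' n (D n) hA with h | ⟨h, -⟩
    · exact Or.inr (h.weaken' (hsub (n + 1)))
    · exact Or.inl (.assumption (hsub (n + 1) (Or.inr h)) hA)
  · intro x A d N
    obtain ⟨n, hn, hA⟩ := he (ex x A) N
    have hW := Derives.wellSorted d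
    rcases hnext' n (D n) (hA ▸ hW) with h | ⟨-, h⟩
    · rw [hA] at h
      exact (hcons (.impE (h.weaken' (hsub (n + 1))) d)).elim
    · obtain ⟨y, h1, h2, h3, h4⟩ := h x A hA
      obtain ⟨i, hi⟩ := hW.1
      exact ⟨y, hn.trans h1, h2, h3, .assumption (hsub (n + 1) (Or.inr h4))
        (hW.2.subst hi (.var (h2.trans hi)))⟩

namespace IsHenkin

theorem neg_iff (H : S.IsHenkin U) (hA : S.WellSorted A) : S.Derives U (neg A) ↔ ¬ S.Derives U A :=
  ⟨fun h h' => H.consistent (.impE h h'), (H.complete hA).resolve_left⟩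

theorem dis_iff (H : S.IsHenkin U) (hA : S.WellSorted A) (hB : S.WellSorted B) :
    S.Derives U (dis A B) ↔ S.Derives U A ∨ S.Derives U B := by
  refine ⟨fun h => ?_, fun h => h.elim (.disI₁ hB) (.disI₂ hA)⟩
  by_contra! hn
  rw [← H.neg_iff hA, ← H.neg_iff hB] at hn
  refine H.consistent (.disE h (.impE (hn.1.weaken' (Set.subset_insert _ _)) ?_)
    (.impE (hn.2.weaken' (Set.subset_insert _ _)) ?_))
  · exact .assumption (Or.inl rfl) hA
  · exact .assumption (Or.inl rfl) hB

theorem imp_iff (H : S.IsHenkin U) (hA : S.WellSorted A) (hB : S.WellSorted B) :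
    S.Derives U (imp A B) ↔ (S.Derives U A → S.Derives U B) := by
  refine ⟨fun h h' => .impE h h', fun h => ?_⟩
  by_cases hd : S.Derives U A
  · exact .impI hA ((h hd).weaken' (Set.subset_insert _ _))
  · rw [← H.neg_iff hA] at hd
    exact .impI hA (.botE hB (.impE (hd.weaken' (Set.subset_insert _ _))
      (.assumption (Or.inl rfl) hA)))

theorem ex_neg_of_not_all (H : S.IsHenkin U) (hA : S.WellSorted (all x A)) (h : ¬ S.Derives U (all x A)) :
    S.Derives U (ex x (neg A)) := by
  have hnA : S.WellSorted (neg A) := ⟨hA.2, trivial⟩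
  have hE : S.WellSorted (ex x (neg A)) := ⟨hA.1, hnA⟩
  by_contra hn
  rw [← H.neg_iff hE] at hn
  -- ¬∃x¬A → ∀x A is derived without assumptions and then weakened, because x may be free in U and
  -- could not be generalized there.
  refine h (.impE (.weaken (Set.empty_subset U) (.impI (A := neg (ex x (neg A)))
    ⟨hE, trivial⟩ (.allI ?_ hA (.raa hA.2 (.impE
      (.assumption (Or.inr (Or.inl rfl)) ⟨hE, trivial⟩) (?_ : Deriv _ _ _ _ _)))))) hn)
  · rintro B (rfl | h)
    · simp [neg, fv]
    · exact h.elim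
  · obtain ⟨i, hi⟩ := hA.1
    refine .exI (t := vt x) (freeFor_vt_self x _) ⟨i, hi, .var hi⟩ hE ?_
    rw [subst_vt_self]
    exact .assumption (Or.inl rfl) hnA

end IsHenkin

end ManySortedSignature

/-! ### Unsorted semantics and soundness -/

namespace Fml

open FirstOrder.Language

variable {L : FirstOrder.Language.{u, v}} {M : Type*} [L.Structure M]

/-- Satisfaction of a formula in a structure under an assignment. -/
def Sat (v : ℕ → M) : Fml L → Prop
  | bot => False
  | eq s t => s.realize v = t.realize v
  | rel R ts => Structure.RelMap R fun k => (ts k).realize v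
  | con A B => Sat v A ∧ Sat v B
  | dis A B => Sat v A ∨ Sat v B
  | imp A B => Sat v A → Sat v B
  | all x A => ∀ d, Sat (Function.update v x d) A
  | ex x A => ∃ d, Sat (Function.update v x d) A

theorem sat_congr {v v' : ℕ → M} {A : Fml L} (h : ∀ x ∈ A.fv, v x = v' x) :
    Sat v A ↔ Sat v' A := by
  induction A generalizing v v' with
  | bot => rfl
  | eq s t =>
    simp only [fv, Finset.mem_union] at h
    simp only [Sat, Term.realize_congr fun x hx => h x (Or.inl hx),
      Term.realize_congr fun x hx => h x (Or.inr hx)]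
  | rel R ts =>
    simp only [fv, Finset.mem_biUnion, Finset.mem_univ, true_and] at h
    simp only [Sat, fun k => Term.realize_congr (s := ts k) fun x hx => h x ⟨k, hx⟩]
  | con A B h1 h2 | dis A B h1 h2 | imp A B h1 h2 =>
    simp only [fv, Finset.mem_union] at h
    simp only [Sat, h1 fun x hx => h x (Or.inl hx), h2 fun x hx => h x (Or.inr hx)]
  | all y A ih | ex y A ih =>
    have : ∀ d, Sat (Function.update v y d) A ↔ Sat (Function.update v' y d) A := by
      refine fun d => ih fun x hx => ?_
      by_cases e : x = y
      · subst e; simp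
      · simp [e, h x (by simp [fv, e, hx])]
    simp only [Sat, this]

theorem sat_update {v : ℕ → M} {x : ℕ} {d : M} {A : Fml L} (h : x ∉ A.fv) :
    Sat (Function.update v x d) A ↔ Sat v A :=
  sat_congr fun _ hy => Function.update_of_ne (fun e : _ = x => h (e ▸ hy)) _ _

theorem realize_substTerm (v : ℕ → M) (x : ℕ) (t s : L.Term ℕ) :
    (substTerm x t s).realize v = s.realize (Function.update v x (t.realize v)) := by
  rw [substTerm, Term.realize_subst]
  congr 1
  funext y
  by_cases e : y = x
  · subst e; simp
  · simp [e]

theorem sat_subst {v : ℕ → M} {x : ℕ} {t : L.Term ℕ} {A : Fml L} (h : FreeFor x t A) :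
    Sat v (subst x t A) ↔ Sat (Function.update v x (t.realize v)) A := by
  induction A generalizing v with
  | bot => rfl
  | eq | rel => simp only [subst, Sat, realize_substTerm]
  | con A B h1 h2 | dis A B h1 h2 | imp A B h1 h2 => simp only [subst, Sat, h1 h.1, h2 h.2]
  | all y A ih | ex y A ih =>
    -- If x is not free, `FreeFor` says nothing about t, but the substitution and the update are
    -- both void. The formula `all y A` serves the existential case too, its free variables being
    -- the same by definition.
    by_cases hx : x ∈ (all y A).fv
    swap
    · rw [Fml.subst_eq_self (by exact hx), sat_update (by exact hx)]
    obtain ⟨hy, h⟩ := h.resolve_left (not_not.2 hx)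
    have e : y ≠ x := by rintro rfl; simp [fv] at hx
    have : ∀ d, t.realize (Function.update v y d) = t.realize v := fun d =>
      Term.realize_congr fun z hz => Function.update_of_ne (fun e : z = y => hy (e ▸ hz)) _ _
    simp only [subst, e, if_false, Sat, ih h, this, Function.update_comm e]

theorem sat_foldr_all {A : Fml L} (h : ∀ v : ℕ → M, Sat v A) (l : List ℕ) (v : ℕ → M) :
    Sat v (l.foldr all A) := by
  induction l generalizing v with
  | nil => exact h v
  | cons x l ih => exact fun d => ih _

theorem sat_close {A : Fml L} (h : ∀ v : ℕ → M, Sat v A) (v : ℕ → M) : Sat v A.close :=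
  sat_foldr_all h _ v

theorem sat_impList {v : ℕ → M} {l : List (Fml L)} {B : Fml L} :
    Sat v (impList l B) ↔ ((∀ A ∈ l, Sat v A) → Sat v B) := by
  have hc : ∀ (l : List (Fml L)) (A : Fml L),
      Sat v (conjList A l) ↔ Sat v A ∧ ∀ B ∈ l, Sat v B := by
    intro l
    induction l with
    | nil => simp [conjList]
    | cons B l ih => simp [conjList, Sat, ih]
  cases l with
  | nil => simp [impList]
  | cons A l => simp [impList, Sat, hc]

end Fml

namespace FOL

open Fml FirstOrder.Language

variable {L : FirstOrder.Language.{u, v}} {M : Type*} [L.Structure M]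

theorem sat_of_mem_eqAx {A : Fml L} (h : A ∈ EqAx L) (v : ℕ → M) : Sat v A := by
  cases h with
  | refl x => exact sat_close (A := eq (vt x) (vt x)) (fun _ => rfl) v
  | symm x y => exact sat_close (fun v h => h.symm) v
  | trans x y z => exact sat_close (fun v h => h.1.trans h.2) v
  | rel R x y =>
    refine sat_close (fun v => sat_impList.2 fun h => ?_) v
    intro h'
    simp only [List.mem_ofFn, forall_exists_index, forall_apply_eq_imp_iff, Sat,
      Term.realize_var] at h h' ⊢
    simpa only [← h] using h'
  | func f x y =>
    refine sat_close (fun v => sat_impList.2 fun h => ?_) v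
    simp only [List.mem_ofFn, forall_exists_index, forall_apply_eq_imp_iff, Sat,
      Term.realize_var, Term.realize_func] at h ⊢
    simp only [h]

theorem Derives.sat {Γ : Set (Fml L)} {A : Fml L} (d : Derives Γ A) {v : ℕ → M}
    (h : ∀ B ∈ Γ, Sat v B) : Sat v A := by
  have hins : ∀ {Γ : Set (Fml L)} {A : Fml L} {v : ℕ → M}, (∀ B ∈ Γ, Sat v B) → Sat v A →
      ∀ B ∈ insert A Γ, Sat v B := by
    rintro Γ A v h hA B (rfl | hB)
    · exact hA
    · exact h B hB
  induction d generalizing v with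
  | assumption hA _ => exact h _ hA
  | ax hA _ => exact sat_of_mem_eqAx hA v
  | weaken hs _ ih => exact ih fun B hB => h B (hs hB)
  | conI _ _ h1 h2 => exact ⟨h1 h, h2 h⟩
  | conE₁ _ ih => exact (ih h).1
  | conE₂ _ ih => exact (ih h).2
  | disI₁ _ _ ih => exact Or.inl (ih h)
  | disI₂ _ _ ih => exact Or.inr (ih h)
  | disE _ _ _ h1 h2 h3 =>
    exact (h1 h).elim (fun k => h2 (hins h k)) (fun k => h3 (hins h k))
  | impI _ _ ih => exact fun k => ih (hins h k)
  | impE _ _ h1 h2 => exact h1 h (h2 h)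
  | botE _ _ ih => exact (ih h).elim
  | raa _ _ ih => exact by_contra fun k => ih (hins h k)
  | allI hx _ _ ih => exact fun d => ih fun B hB => (sat_update (hx B hB)).2 (h B hB)
  | allE hf _ _ ih => exact (sat_subst hf).2 (ih h _)
  | exI hf _ _ _ ih => exact ⟨_, (sat_subst hf).1 (ih h)⟩
  | exE hx hC _ _ h1 h2 =>
    obtain ⟨d, hd⟩ := h1 fun B hB => h B (Or.inl hB)
    exact (sat_update hC).1 (h2 (hins
      (fun B hB => (sat_update (hx B hB)).2 (h B (Or.inr hB))) hd))

end FOL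

/-! ### Provable ≈ is a congruence -/

namespace ManySortedSignature

open Fml FirstOrder.Language

variable {L : FirstOrder.Language.{u, v}} {ι : Type w} {S : ManySortedSignature L ι}
  {U : Set (Fml L.withApprox)}

theorem substAll_approx (σ : ℕ → L.withApprox.Term ℕ) (s t : L.withApprox.Term ℕ) :
    substAll σ (approx s t) = approx (s.subst σ) (t.subst σ) := by
  simp only [approx, substAll]
  congr 1
  funext k
  fin_cases k <;> rfl

theorem subst_approx (x : ℕ) (r s t : L.withApprox.Term ℕ) :
    subst x r (approx s t) = approx (substTerm x r s) (substTerm x r t) := by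
  simp only [approx, subst]
  congr 1
  funext k
  fin_cases k <;> rfl

theorem qf_approx (s t : L.withApprox.Term ℕ) : (approx s t).QF :=
  trivial

theorem wellSorted_approx {s t : L.withApprox.Term ℕ} :
    S.withApprox.WellSorted (approx s t) ↔
      (∃ i, S.withApprox.HasSort s i) ∧ ∃ i, S.withApprox.HasSort t i := by
  constructor
  · rintro ⟨i, -, h⟩
    exact ⟨⟨_, h 0⟩, ⟨_, h 1⟩⟩
  · rintro ⟨⟨i, hi⟩, ⟨j, hj⟩⟩
    refine ⟨![i, j], trivial, fun k => ?_⟩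
    fin_cases k
    · exact hi
    · exact hj

theorem fv_approxAx {B : Fml L.withApprox} (h : B ∈ S.ApproxAx) : B.fv = ∅ := by
  cases h <;> exact fv_close _

theorem exists_approxAx_instance (hU : S.ApproxAx ⊆ U) {κ : Type*} [Finite κ]
    (t : κ → L.withApprox.Term ℕ) (i : κ → ι) (ht : ∀ k, S.withApprox.HasSort (t k) (i k)) :
    ∃ (x : κ → ℕ) (σ : ℕ → L.withApprox.Term ℕ), (∀ k, S.varSort (x k) = some (i k)) ∧
      (∀ k, σ (x k) = t k) ∧
      ∀ {A : Fml L.withApprox}, A.close ∈ S.ApproxAx → A.QF → S.withApprox.WellSorted A →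
        S.withApprox.Derives U (A.substAll σ) := by
  obtain ⟨x, σ, hx, hσ, h⟩ := S.exists_generic t i
  refine ⟨x, σ, hx, hσ, fun {A} hAx hA hW => ?_⟩
  -- The instance is derived from the closed axioms alone and only then weakened to U, in which the
  -- generic variables may be free.
  refine Deriv.weaken hU (h S.withApprox.admissible (fun k => ⟨i k, hx k, ht k⟩)
    (fun k B hB => by simp [fv_approxAx hB]) hA
    (.of_close S.withApprox.admissible (.assumption hAx hW.close)))

variable {s t r : L.withApprox.Term ℕ} {i j : ι}

theorem Derives.hasSort_of_approx (d : S.withApprox.Derives U (approx s t)) :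
    (∃ i, S.withApprox.HasSort s i) ∧ ∃ i, S.withApprox.HasSort t i :=
  wellSorted_approx.1 (Derives.wellSorted d)

theorem wellSorted_approx_vt {x y : ℕ} (hx : S.varSort x = some i) (hy : S.varSort y = some j) :
    S.withApprox.WellSorted (approx (vt x) (vt y)) :=
  wellSorted_approx.2 ⟨⟨i, .var hx⟩, ⟨j, .var hy⟩⟩

theorem derives_approx_refl (hU : S.ApproxAx ⊆ U) (ht : S.withApprox.HasSort t i) :
    S.withApprox.Derives U (approx t t) := by
  obtain ⟨x, σ, hx, hσ, h⟩ := exists_approxAx_instance hU (fun _ : Unit => t) (fun _ => i)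
    fun _ => ht
  have := h (.refl (hx ())) (qf_approx _ _) (wellSorted_approx_vt (hx ()) (hx ()))
  rwa [substAll_approx, Term.subst, hσ] at this

theorem derives_approx_symm (hU : S.ApproxAx ⊆ U) (d : S.withApprox.Derives U (approx s t)) :
    S.withApprox.Derives U (approx t s) := by
  obtain ⟨⟨i, hs⟩, j, ht⟩ := d.hasSort_of_approx
  obtain ⟨x, σ, hx, hσ, h⟩ := exists_approxAx_instance hU ![s, t] ![i, j]
    (Fin.forall_fin_two.2 ⟨hs, ht⟩)
  rw [Fin.forall_fin_two] at hx hσ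
  have := h (.symm hx.1 hx.2) ⟨qf_approx _ _, qf_approx _ _⟩
    ⟨wellSorted_approx_vt hx.1 hx.2, wellSorted_approx_vt hx.2 hx.1⟩
  simp only [substAll, substAll_approx, Term.subst, hσ] at this
  exact this.impE d

theorem derives_approx_trans (hU : S.ApproxAx ⊆ U) (d : S.withApprox.Derives U (approx s t))
    (d' : S.withApprox.Derives U (approx t r)) : S.withApprox.Derives U (approx s r) := by
  obtain ⟨⟨i, hs⟩, j, ht⟩ := d.hasSort_of_approx
  obtain ⟨-, k, hr⟩ := d'.hasSort_of_approx
  obtain ⟨x, σ, hx, hσ, h⟩ := exists_approxAx_instance hU ![s, t, r] ![i, j, k]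
    (Fin.forall_fin_succ.2 ⟨hs, Fin.forall_fin_two.2 ⟨ht, hr⟩⟩)
  simp only [Fin.forall_fin_succ, IsEmpty.forall_iff, and_true] at hx hσ
  obtain ⟨hx0, hx1, hx2⟩ := hx
  obtain ⟨h0, h1, h2⟩ := hσ
  have := h (.trans hx0 hx1 hx2) ⟨⟨qf_approx _ _, qf_approx _ _⟩, qf_approx _ _⟩
    ⟨⟨wellSorted_approx_vt hx0 hx1, wellSorted_approx_vt hx1 hx2⟩, wellSorted_approx_vt hx0 hx2⟩
  simp only [substAll, substAll_approx, Term.subst, h0, h1, h2] at this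
  exact this.impE (.conI d d')

/-- The axioms linking = and ≈ exist only for equal sorts, hence the common sort i. -/
theorem derives_eq_iff (hU : S.ApproxAx ⊆ U) (hs : S.withApprox.HasSort s i)
    (ht : S.withApprox.HasSort t i) :
    S.withApprox.Derives U (eq s t) ↔ S.withApprox.Derives U (approx s t) := by
  obtain ⟨x, σ, hx, hσ, h⟩ := exists_approxAx_instance hU ![s, t] ![i, i]
    (Fin.forall_fin_two.2 ⟨hs, ht⟩)
  rw [Fin.forall_fin_two] at hx hσ
  have hW : S.withApprox.WellSorted (eq (vt (x 0)) (vt (x 1))) := ⟨i, .var hx.1, .var hx.2⟩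
  have h1 := h (.of_eq hx.1 hx.2) ⟨trivial, qf_approx _ _⟩ ⟨hW, wellSorted_approx_vt hx.1 hx.2⟩
  have h2 := h (.to_eq hx.1 hx.2) ⟨qf_approx _ _, trivial⟩ ⟨wellSorted_approx_vt hx.1 hx.2, hW⟩
  simp only [substAll, substAll_approx, Term.subst, hσ] at h1 h2
  exact ⟨h1.impE, h2.impE⟩

theorem derives_rel_congr (hU : S.ApproxAx ⊆ U) {n : ℕ} {R : L.Relations n}
    {ts ts' : Fin n → L.withApprox.Term ℕ}
    (hts' : S.withApprox.WellSorted (rel (ApproxRel.base R : ApproxRel L n) ts'))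
    (hE : ∀ k, S.withApprox.Derives U (approx (ts k) (ts' k)))
    (d : S.withApprox.Derives U (rel (ApproxRel.base R : ApproxRel L n) ts)) :
    S.withApprox.Derives U (rel (ApproxRel.base R : ApproxRel L n) ts') := by
  obtain ⟨i, hi, hs⟩ : S.withApprox.WellSorted (rel (ApproxRel.base R : ApproxRel L n) ts) :=
    Derives.wellSorted d
  obtain ⟨j, hj, ht⟩ := hts'
  -- The 2n terms are substituted at once. The ranks i and j may differ, which strict congruence
  -- would not allow.
  obtain ⟨x, σ, hx, hσ, h⟩ := exists_approxAx_instance hU (Sum.elim ts ts') (Sum.elim i j)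
    (Sum.forall.2 ⟨hs, ht⟩)
  rw [Sum.forall] at hx hσ
  have := h (.rel hi hj hx.1 hx.2) (QF.impList (by simp [List.mem_ofFn, qf_approx]) ⟨trivial, trivial⟩)
    (WellSorted.impList (by
        simp only [List.mem_ofFn]
        rintro _ ⟨k, rfl⟩
        exact wellSorted_approx_vt (hx.1 k) (hx.2 k))
      ⟨⟨i, hi, fun k => .var (hx.1 k)⟩, ⟨j, hj, fun k => .var (hx.2 k)⟩⟩)
  rw [substAll_impList, List.map_ofFn] at this
  have := this.of_impList (by
    simp only [List.mem_ofFn]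
    rintro _ ⟨k, rfl⟩
    rw [Function.comp_apply, substAll_approx, Term.subst, Term.subst, hσ.1, hσ.2]
    exact hE k)
  simp only [substAll, Term.subst, hσ, Sum.elim_inl, Sum.elim_inr] at this
  exact this.impE d

theorem derives_func_congr (hU : S.ApproxAx ⊆ U) {n : ℕ} {f : L.Functions n}
    {ts ts' : Fin n → L.withApprox.Term ℕ}
    (hs : S.withApprox.HasSort (.func (f : L.Functions n) ts) i)
    (ht : S.withApprox.HasSort (.func (f : L.Functions n) ts') j)
    (hE : ∀ k, S.withApprox.Derives U (approx (ts k) (ts' k))) :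
    S.withApprox.Derives U
      (approx (.func (f : L.Functions n) ts) (.func (f : L.Functions n) ts')) := by
  cases hs with
  | @func _ _ _ a _ hs hi =>
  cases ht with
  | @func _ _ _ b _ ht hj =>
  obtain ⟨x, σ, hx, hσ, h⟩ := exists_approxAx_instance hU (Sum.elim ts ts') (Sum.elim a b)
    (Sum.forall.2 ⟨hs, ht⟩)
  rw [Sum.forall] at hx hσ
  have := h (.func hi hj hx.1 hx.2) (QF.impList (by simp [List.mem_ofFn, qf_approx]) (qf_approx _ _))
    (WellSorted.impList (by
        simp only [List.mem_ofFn]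
        rintro _ ⟨k, rfl⟩
        exact wellSorted_approx_vt (hx.1 k) (hx.2 k))
      (wellSorted_approx.2 ⟨⟨i, .func (fun k => .var (hx.1 k)) hi⟩,
        ⟨j, .func (fun k => .var (hx.2 k)) hj⟩⟩))
  rw [substAll_impList, List.map_ofFn] at this
  have := this.of_impList (by
    simp only [List.mem_ofFn]
    rintro _ ⟨k, rfl⟩
    rw [Function.comp_apply, substAll_approx, Term.subst, Term.subst, hσ.1, hσ.2]
    exact hE k)
  simp only [substAll_approx, Term.subst, hσ, Sum.elim_inl, Sum.elim_inr] at this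
  exact this

end ManySortedSignature

/-! ### The term model and the truth lemma -/

namespace ManySortedSignature

open Fml FirstOrder.Language

variable {L : FirstOrder.Language.{u, v}} {ι : Type w} {S : ManySortedSignature L ι}
  {U : Set (Fml L.withApprox)}

/-- Terms are identified if they are provably `≈`-equal. -/
def termSetoid (hU : S.ApproxAx ⊆ U) : Setoid (L.withApprox.Term ℕ) where
  -- Ill-sorted terms are not provably ≈ to themselves, so reflexivity is added by hand.
  r s t := s = t ∨ S.withApprox.Derives U (approx s t)
  iseqv :=
    { refl := fun _ => Or.inl rfl
      symm := by
        rintro s t (rfl | h)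
        · exact Or.inl rfl
        · exact Or.inr (derives_approx_symm hU h)
      trans := by
        rintro s t r (rfl | h) (rfl | h')
        · exact Or.inl rfl
        · exact Or.inr h'
        · exact Or.inr h
        · exact Or.inr (derives_approx_trans hU h h') }

/-- The unsorted term model: all terms (also the ill-sorted ones) up to provable `≈`. -/
def TermModel (hU : S.ApproxAx ⊆ U) : Type u :=
  Quotient (termSetoid hU)

namespace TermModel

variable (hU : S.ApproxAx ⊆ U) {t : L.withApprox.Term ℕ} {i j : ι}

/-- The class of a term. -/
def mk (t : L.withApprox.Term ℕ) : TermModel hU :=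
  Quotient.mk (termSetoid hU) t

variable {hU}

theorem mk_eq_mk {s t : L.withApprox.Term ℕ} (hs : S.withApprox.HasSort s i) :
    mk hU s = mk hU t ↔ S.withApprox.Derives U (approx s t) := by
  refine Quotient.eq.trans ⟨?_, Or.inr⟩
  rintro (rfl | h)
  · exact derives_approx_refl hU hs
  · exact h

open Classical in
-- A function is evaluated on representatives that make the term well sorted; where there are none,
-- the value is an arbitrary default. Relations and Q_i likewise ask for some suitable
-- representatives, as a class may mix sorts.
noncomputable instance : (L.withSorts ι).Structure (TermModel hU) where
  funMap {n} (f : L.Functions n) a :=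
    if h : ∃ ts : Fin n → L.withApprox.Term ℕ,
        (∃ j, S.withApprox.HasSort (.func (f : L.Functions n) ts) j) ∧ ∀ k, mk hU (ts k) = a k then
      mk hU (.func (f : L.Functions n) h.choose)
    else mk hU (vt 0)
  RelMap {n} (R : StarRel L ι n) a :=
    match n, R, a with
    | n, .base R, a => ∃ ts, S.withApprox.Derives U (rel (ApproxRel.base R : ApproxRel L n) ts) ∧
        ∀ k, mk hU (ts k) = a k
    | _, .sortPred i, a => ∃ t, S.withApprox.HasSort t i ∧ mk hU t = a 0

/-- The chosen representatives may have another rank than `ts`; congruence of ≈ across ranks makes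
the values agree. -/
theorem funMap_mk {n : ℕ} {f : L.Functions n} {ts : Fin n → L.withApprox.Term ℕ}
    (h : S.withApprox.HasSort (.func (f : L.Functions n) ts) j) :
    Structure.funMap (L := L.withSorts ι) (f : L.Functions n) (fun k => mk hU (ts k)) =
      mk hU (.func (f : L.Functions n) ts) := by
  have hex : ∃ ts' : Fin n → L.withApprox.Term ℕ,
      (∃ j, S.withApprox.HasSort (.func (f : L.Functions n) ts') j) ∧
        ∀ k, mk hU (ts' k) = mk hU (ts k) := ⟨ts, ⟨j, h⟩, fun _ => rfl⟩
  refine (dif_pos hex).trans ?_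
  obtain ⟨⟨i, hi⟩, hE⟩ := hex.choose_spec
  rw [mk_eq_mk hi]
  refine derives_func_congr hU hi h fun k => ?_
  cases hi with
  | func hi _ => exact (mk_eq_mk (hi k)).1 (hE k)

theorem relMap_base {n : ℕ} {R : L.Relations n} {ts : Fin n → L.withApprox.Term ℕ}
    (h : S.withApprox.WellSorted (rel (ApproxRel.base R : ApproxRel L n) ts)) :
    Structure.RelMap (L := L.withSorts ι) (StarRel.base R : StarRel L ι n)
        (fun k => mk hU (ts k)) ↔
      S.withApprox.Derives U (rel (ApproxRel.base R : ApproxRel L n) ts) := by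
  refine ⟨?_, fun d => ⟨ts, d, fun _ => rfl⟩⟩
  rintro ⟨ts', d, hE⟩
  obtain ⟨i, -, hi⟩ : S.withApprox.WellSorted (rel (ApproxRel.base R : ApproxRel L n) ts') :=
    Derives.wellSorted d
  exact derives_rel_congr hU h (fun k => (mk_eq_mk (hi k)).1 (hE k)) d

theorem sat_sortPred {v : ℕ → TermModel hU} {t : (L.withSorts ι).Term ℕ} :
    Sat v (sortPred i t) ↔ ∃ s, S.withApprox.HasSort s i ∧ mk hU s = t.realize v :=
  Iff.rfl

variable (hU) in
/-- The canonical assignment. -/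
def assignment (x : ℕ) : TermModel hU :=
  mk hU (vt x)

theorem realize_starTerm (h : S.withApprox.HasSort t i) :
    (starTerm ι t).realize (assignment hU) = mk hU t := by
  induction h with
  | var h => rfl
  | func h1 h2 ih =>
    rw [← funMap_mk (.func h1 h2), ← funext ih]
    rfl

/-- Every sort has variables, so no Q_i is empty. For the function axioms, representatives of the
prescribed sorts give a well-sorted term, whose class is the value. -/
theorem sat_sortAx {B : Fml (L.withSorts ι)} (h : B ∈ S.SortAx) (v : ℕ → TermModel hU) :
    Sat v B := by
  cases h with
  | nonempty x i =>
    obtain ⟨y, hy⟩ := (S.varSort_infinite i).nonempty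
    exact ⟨mk hU (vt y), sat_sortPred.2 ⟨vt y, .var hy, by simp [Term.realize_var]⟩⟩
  | @func n f i j x hj =>
    refine sat_close (fun v => sat_impList.2 fun h => ?_) v
    simp only [List.mem_ofFn, forall_exists_index, forall_apply_eq_imp_iff, sat_sortPred,
      Term.realize_var] at h
    choose ts hts hE using h
    have hf : S.withApprox.HasSort (.func (f : L.Functions n) ts) j := .func hts hj
    refine sat_sortPred.2 ⟨_, hf, ?_⟩
    rw [← funMap_mk hf, funext hE]
    rfl

/-- ∃z (z ≈ t) is derivable, with t itself as instance, and its Henkin witnesses are unbounded.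
Elements of Q_i are thus named by variables avoiding any finite set, so no capture arises in the
truth lemma. -/
theorem exists_assignment_eq (H : S.withApprox.IsHenkin U) (ht : S.withApprox.HasSort t i)
    (F : Finset ℕ) : ∃ y ∉ F, S.varSort y = some i ∧ assignment hU y = mk hU t := by
  obtain ⟨z, hz, hz'⟩ := (S.varSort_infinite i).exists_notMem_finset t.varFinset
  have hz : S.varSort z = some i := hz
  have d : S.withApprox.Derives U (ex z (approx (vt z) t)) := by
    refine .exI (t := t) ((qf_approx _ _).freeFor _ _) ⟨i, hz, ht⟩
      ⟨⟨i, hz⟩, wellSorted_approx.2 ⟨⟨i, .var hz⟩, i, ht⟩⟩ ?_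
    rw [subst_approx, substTerm_eq_self hz']
    simpa [substTerm, Term.subst, Derives] using derives_approx_refl hU ht
  -- The bound exceeds every element of F.
  obtain ⟨y, hy, hyz, -, d⟩ := H.witness d (F.sup id + 1)
  refine ⟨y, fun hyF => ?_, Eq.trans hyz hz, ?_⟩
  · have := Finset.le_sup (f := id) hyF
    simp only [id] at this
    omega
  · rw [assignment, mk_eq_mk (.var (Eq.trans hyz hz))]
    rw [subst_approx, substTerm_eq_self hz'] at d
    simpa [substTerm, Term.subst] using d

theorem sat_star_subst {x y : ℕ} {A : Fml L.withApprox} (hy : y ∉ A.vars) :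
    Sat (assignment hU) (S.star (subst x (vt y) A)) ↔
      Sat (Function.update (assignment hU) x (assignment hU y)) (S.star A) := by
  rw [star_subst, sat_subst (S.freeFor_star (freeFor_vt_of_notMem_vars hy))]
  rfl

/-- The truth lemma. -/
theorem sat_star_iff (H : S.withApprox.IsHenkin U) {A : Fml L.withApprox}
    (hA : S.withApprox.WellSorted A) :
    Sat (assignment hU) (S.star A) ↔ S.withApprox.Derives U A := by
  -- Quantifier cases use A[y/x], which is not a subformula but has the size of A.
  induction hn : A.size using Nat.strong_induction_on generalizing A with
  | _ n ih =>
  have ih' : ∀ {B : Fml L.withApprox}, B.size < A.size → S.withApprox.WellSorted B →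
      (Sat (assignment hU) (S.star B) ↔ S.withApprox.Derives U B) :=
    fun hB hW => ih _ (hn ▸ hB) hW rfl
  clear ih hn
  cases A with
  | bot => exact ⟨False.elim, H.consistent⟩
  | eq s t =>
    obtain ⟨i, hs, ht⟩ := hA
    simp only [star, Sat, realize_starTerm hs, realize_starTerm ht]
    rw [mk_eq_mk hs, derives_eq_iff hU hs ht]
  | rel R ts =>
    cases R with
    | base R =>
      obtain ⟨i, hi, hs⟩ := id hA
      refine Iff.trans ?_ (relMap_base (hU := hU) hA)
      simp only [star, starRel, Sat, fun k => realize_starTerm (hU := hU) (hs k)]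
    | approx =>
      obtain ⟨i, hi, hs⟩ := id hA
      simp only [star, starRel, Sat, fun k => realize_starTerm (hU := hU) (hs k)]
      rw [mk_eq_mk (hs 0)]
      have : ts = ![ts 0, ts 1] := by funext k; fin_cases k <;> rfl
      rw [approx, ← this]
  | con A B =>
    simp only [size] at ih'
    simp only [star, Sat, ih' (B := A) (by omega) hA.1, ih' (B := B) (by omega) hA.2]
    exact ⟨fun h => .conI h.1 h.2, fun h => ⟨.conE₁ h, .conE₂ h⟩⟩
  | dis A B =>
    simp only [size] at ih'
    simp only [star, Sat, ih' (B := A) (by omega) hA.1, ih' (B := B) (by omega) hA.2]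
    exact (H.dis_iff hA.1 hA.2).symm
  | imp A B =>
    simp only [size] at ih'
    simp only [star, Sat, ih' (B := A) (by omega) hA.1, ih' (B := B) (by omega) hA.2]
    exact (H.imp_iff hA.1 hA.2).symm
  | all x A =>
    obtain ⟨i, hi⟩ := id hA.1
    replace hi : S.varSort x = some i := hi
    have inst : ∀ {y}, S.varSort y = some i → y ∉ A.vars →
        (Sat (Function.update (assignment hU) x (assignment hU y)) (S.star A) ↔
          S.withApprox.Derives U (subst x (vt y) A)) := by
      intro y hy hyA
      rw [← sat_star_subst hyA, ih' (by simp [size_subst, size]) (hA.2.subst hi (.var hy))]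
    simp only [star, hi, Sat, sat_sortPred, Term.realize_var, Function.update_self]
    constructor
    · intro h
      -- Otherwise ¬A has a witness y of sort i, while A[y/x] is derivable because its translation
      -- holds.
      by_contra hn
      obtain ⟨y, -, hy, hyA, d⟩ := H.witness (H.ex_neg_of_not_all hA hn) 0
      replace hy : S.varSort y = some i := Eq.trans hy hi
      refine H.consistent (Deriv.impE d ((inst hy fun h => hyA ?_).1 (h _ ⟨_, .var hy, rfl⟩)))
      simp [neg, vars, h]
    · rintro d _ ⟨t, ht, rfl⟩
      -- The term t need not be free for x in A; a variable outside A with the same class replaces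
      -- it.
      obtain ⟨y, hyA, hy, hyt⟩ := exists_assignment_eq (hU := hU) H ht A.vars
      rw [← hyt, inst hy hyA]
      exact .allE (freeFor_vt_of_notMem_vars hyA) ⟨i, hi, .var hy⟩ d
  | ex x A =>
    obtain ⟨i, hi⟩ := id hA.1
    replace hi : S.varSort x = some i := hi
    have inst : ∀ {y}, S.varSort y = some i → y ∉ A.vars →
        (Sat (Function.update (assignment hU) x (assignment hU y)) (S.star A) ↔
          S.withApprox.Derives U (subst x (vt y) A)) := by
      intro y hy hyA
      rw [← sat_star_subst hyA, ih' (by simp [size_subst, size]) (hA.2.subst hi (.var hy))]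
    simp only [star, hi, Sat, sat_sortPred, Term.realize_var, Function.update_self]
    constructor
    · rintro ⟨_, ⟨t, ht, rfl⟩, h⟩
      obtain ⟨y, hyA, hy, hyt⟩ := exists_assignment_eq (hU := hU) H ht A.vars
      rw [← hyt, inst hy hyA] at h
      exact .exI (freeFor_vt_of_notMem_vars hyA) ⟨i, hi, .var hy⟩ hA h
    · intro d
      obtain ⟨y, -, hy, hyA, d⟩ := H.witness d 0
      replace hy : S.varSort y = some i := Eq.trans hy hi
      exact ⟨_, ⟨_, .var hy, rfl⟩, (inst hy hyA).2 d⟩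

end TermModel

theorem derivesApprox_of_derives_star {Γ : Set (Fml L.withApprox)} {φ : Fml L.withApprox}
    (hΓ : ∀ ψ ∈ Γ, S.withApprox.IsSentence ψ) (hφ : S.withApprox.IsSentence φ)
    (d : FOL.Derives (S.star '' Γ ∪ S.SortAx) (S.star φ)) : S.DerivesApprox Γ φ := by
  by_contra hn
  have hc : ¬ S.withApprox.Derives (insert (neg φ) (Γ ∪ S.ApproxAx)) bot :=
    fun d => hn (.raa hφ.1 d)
  -- Γ, ¬φ and Eq^≈ are closed, which leaves all variables available as witnesses.
  obtain ⟨U, hTU, H⟩ := exists_isHenkin (by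
    rintro B (rfl | hB | hB)
    · simp [neg, fv, hφ.2]
    · exact (hΓ B hB).2
    · exact fv_approxAx hB) hc
  have hU : S.ApproxAx ⊆ U := fun B hB => hTU (Or.inr (Or.inr hB))
  have hsat : Sat (TermModel.assignment hU) (S.star φ) := by
    refine d.sat ?_
    rintro _ (⟨ψ, hψ, rfl⟩ | hB)
    · exact (TermModel.sat_star_iff H (hΓ ψ hψ).1).2
        (.assumption (hTU (Or.inr (Or.inl hψ))) (hΓ ψ hψ).1)
    · exact TermModel.sat_sortAx hB _
  exact H.consistent (.impE (.assumption (hTU (Or.inl rfl)) ⟨hφ.1, trivial⟩)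
    ((TermModel.sat_star_iff H hφ.1).1 hsat))

end ManySortedSignature

theorem corollary4p3 {L : FirstOrder.Language.{u, v}} {ι : Type w} (S : ManySortedSignature L ι)
    (Γ : Set (Fml L.withApprox)) (φ : Fml L.withApprox)
    (hΓ : ∀ ψ ∈ Γ, S.withApprox.IsSentence ψ) (hφ : S.withApprox.IsSentence φ) :
    S.DerivesApprox Γ φ ↔ FOL.Derives (S.star '' Γ ∪ S.SortAx) (S.star φ) :=
  ⟨S.derives_star_of_derivesApprox (fun ψ hψ => (hΓ ψ hψ).2) hφ.2,
    ManySortedSignature.derivesApprox_of_derives_star hΓ hφ⟩
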